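/- Let $\Sigma$ be a finite alphabet and $\mathcal D$ an infinite set of data values. A data word is a finite (possibly empty) sequence $w=(a_1,d_1)\cdots(a_n,d_n)\in(\Sigma\times\mathcal D)^*$, and a data language is a set of data words. A set automaton is a tuple $(Q,Y,\Sigma,\Delta,I,F,C)$ with a finite set $Q$ of states, a finite set $Y$ of set names, $I,F\subseteq Q$, $C\subseteq\{0,1\}^Y$, and $\Delta\subseteq Q\times\Sigma\times\{0,1\}^Y\times\mathcal P(Y\times Y)\times\{0,1\}^Y\times\{0,1\}^Y\times Q$. A configuration is a pair $(q,(X_y)_{y\in Y})$ with $q\in Q$ and $X_y\subseteq\mathcal D$. The membership vector of $d\in\mathcal D$ in it is the $z\in\{0,1\}^Y$ with $z_y=1$ iff $d\in X_y$. On reading $(a,d)$, a transition $(q,a,z,\rho,u,v,q')\in\Delta$ may be applied to $(q,(X_y))$ if $z$ is the membership vector of $d$; it leads to $(q',(X''_y))$, where $X'_y=\bigcup_{(x,y)\in\rho}X_x$ and $X''_y$ is obtained from $X'_y$ by first adding $d$ if $u_y=1$ and then removing $d$ if $v_y=1$. A data word is accepted if some run on it leads from a configuration with state in $I$ and all sets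 empty to a configuration with state in $F$ in which every data value that lies in at least one set has its membership vector in $C$. The logic $\mathrm{EMSO}^2[\Sigma,<,+1,\sim,\oplus 1,\mathcal F]$ consists of the sentences $\exists X_1\cdots\exists X_k\,\varphi$, where the $X_m$ range over sets of positions of the data word and $\varphi$ is a first-order sentence with equality that uses only two variables (which may be requantified) and the following predicates on positions: the letters $a\in\Sigma$; $X_1,\dots,X_k$; the order $i<j$; the successor $j=i+1$; $i\sim j$, meaning $d_i=d_j$; the class successor $j=i\oplus1$, meaning that $i<j$, $i\sim j$ and no position strictly between $i$ and $j$ carries the data value $d_i$; and, for every regular language $K\subseteq(\Sigma\times\{0,1\}^k)^*$, the regular predicate $K(i,j)$, meaning that $i<j$ and $b_{i+1}\cdots b_{j-1}\in K$, where $b_m$ consists of $a_m$ and the truth values of $X_1,\dots,X_k$ at position $m$. Theorem. For every data language $L\subseteq(\Sigma\times\mathcal D)^*$, there is a set automaton that accepts exactly the data words in $L$ if and only if there is a sentence of $\mathrm{EMSO}^2[\Sigma,<,+1,\sim,\oplus 1,\mathcal F]$ that is satisfied by exactly the data words in $L$. -/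

import Mathlib

/-! ### Set automata -/

/-- A transition `(p, ℓ, z, ρ, u, v, q)` of a set automaton with states `Q`, set names `Y` and
alphabet `A`. Boolean vectors indexed by `Y` are subsets of `Y`, relations on `Y` are sets of
pairs. -/
structure SetAutTransition (Q Y A : Type*) where
  src : Q
  letter : A
  test : Set Y
  glob : Set (Y × Y)
  add : Set Y
  rem : Set Y
  tgt : Q

/-- A set automaton with states `Q`, set names `Y` and alphabet `A` (all finite where it is used).
`acc` is the family of accepting membership vectors. -/
structure SetAutomaton (Q Y A : Type*) where
  trans : Set (SetAutTransition Q Y A)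
  init : Set Q
  final : Set Q
  acc : Set (Set Y)

/-- A configuration: a state and, for every set name, the data values stored in that set. -/
structure SetAutConfig (Q Y D : Type*) where
  state : Q
  sets : Y → Set D

namespace SetAutConfig

variable {Q Y D : Type*}

/-- The characteristic vector of membership of the data value `d`. -/
def charVec (c : SetAutConfig Q Y D) (d : D) : Set Y := {y | d ∈ c.sets y}

end SetAutConfig

namespace SetAutomaton

variable {Q Y A D : Type*}

/-- The contents of the set `y` after the global update `ρ`: the union of the old contents of the
sets `x` with `(x, y) ∈ ρ`. -/
def globalUpdate (ρ : Set (Y × Y)) (X : Y → Set D) : Y → Set D :=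
  fun y => ⋃ x ∈ {x | (x, y) ∈ ρ}, X x

/-- The local update: the value `d` is added to the sets in `u`, then removed from those in `v`. -/
def localUpdate (u v : Set Y) (d : D) (X : Y → Set D) : Y → Set D :=
  fun y => (X y ∪ {e | e = d ∧ y ∈ u}) \ {e | e = d ∧ y ∈ v}

/-- Reading the pair `p = (a, d)` takes the configuration `c` to `c'` by an applicable
transition. -/
def Step (M : SetAutomaton Q Y A) (c : SetAutConfig Q Y D) (p : A × D)
    (c' : SetAutConfig Q Y D) : Prop :=
  ∃ t ∈ M.trans, t.src = c.state ∧ t.letter = p.1 ∧ t.test = c.charVec p.2 ∧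
    c'.state = t.tgt ∧
    c'.sets = localUpdate t.add t.rem p.2 (globalUpdate t.glob c.sets)

/-- There is a run on the data word from the first configuration to the second one. -/
def Run (M : SetAutomaton Q Y A) :
    SetAutConfig Q Y D → List (A × D) → SetAutConfig Q Y D → Prop
  | c, [], c' => c = c'
  | c, p :: w, c' => ∃ c₁, M.Step c p c₁ ∧ M.Run c₁ w c'

/-- Initial configurations: an initial state, and all sets are empty. -/
def IsInitial (M : SetAutomaton Q Y A) (c : SetAutConfig Q Y D) : Prop :=
  c.state ∈ M.init ∧ ∀ y, c.sets y = ∅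

/-- Accepting configurations: a final state, and every data value that is present in some set has
its membership vector in the accepting family. -/
def IsAccepting (M : SetAutomaton Q Y A) (c : SetAutConfig Q Y D) : Prop :=
  c.state ∈ M.final ∧ ∀ d : D, (∃ y, d ∈ c.sets y) → c.charVec d ∈ M.acc

/-- The data language of a set automaton. -/
def language (M : SetAutomaton Q Y A) (D : Type*) : Set (List (A × D)) :=
  {w | ∃ c c' : SetAutConfig Q Y D, M.IsInitial c ∧ M.Run c w c' ∧ M.IsAccepting c'}

end SetAutomaton

/-- The data language `L` is accepted by a set automaton (with finitely many states and sets). -/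
def AcceptedBySetAutomaton {A D : Type*} (L : Set (List (A × D))) : Prop :=
  ∃ (Q Y : Type) (_ : Finite Q) (_ : Finite Y) (M : SetAutomaton Q Y A), M.language D = L

/-! ### Data words as relational structures; the positions of `w` are `Fin w.length` -/

namespace DataWord

variable {A D : Type*} (w : List (A × D))

/-- Positions carrying the same data value. -/
def Sim (i j : Fin w.length) : Prop := (w.get i).2 = (w.get j).2

/-- `j` is the class successor of `i`: the next position with the same data value. -/
def ClassSucc (i j : Fin w.length) : Prop :=
  i < j ∧ Sim w i j ∧ ∀ m, i < m → m < j → ¬ Sim w i m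

/-- The word over `A × 2ᵏ` that records at each position the letter of `w` and the monadic
predicates `X₁, …, Xₖ` that hold there. -/
def expand {k : ℕ} (X : Fin k → Set (Fin w.length)) : List (A × Set (Fin k)) :=
  List.ofFn fun i => ((w.get i).1, {m | i ∈ X m})

/-- The regular predicate `L(i, j)`: `i < j`, and the factor strictly between them is in `L`. -/
def Factor {k : ℕ} (X : Fin k → Set (Fin w.length)) (L : Language (A × Set (Fin k)))
    (i j : Fin w.length) : Prop :=
  i < j ∧ ((expand w X).take j).drop (i + 1) ∈ L

end DataWord

/-! ### Two-variable logic with regular predicates -/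

/-- Formulas of two-variable first-order logic with equality over the letters of `A`, monadic
predicates `X₁, …, Xₖ`, order, successor, data equality, class successor and regular predicates
over the alphabet `A × 2ᵏ`. The two variables are the elements of `Fin 2`; they may be requantified.
The other connectives and `∀` are the usual abbreviations. -/
inductive FO2 (A : Type*) (k : ℕ)
  | eq (x y : Fin 2)
  | letter (a : A) (x : Fin 2)
  | mon (m : Fin k) (x : Fin 2)
  | lt (x y : Fin 2)
  | succ (x y : Fin 2)
  | sim (x y : Fin 2)
  | csucc (x y : Fin 2)
  | reg (L : Language (A × Set (Fin k))) (hL : L.IsRegular) (x y : Fin 2)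
  | neg (φ : FO2 A k)
  | and (φ ψ : FO2 A k)
  | ex (x : Fin 2) (φ : FO2 A k)

namespace FO2

variable {A D : Type*} {k : ℕ}

/-- The free variables. -/
def freeVars : FO2 A k → Set (Fin 2)
  | eq x y => {x, y}
  | letter _ x => {x}
  | mon _ x => {x}
  | lt x y => {x, y}
  | succ x y => {x, y}
  | sim x y => {x, y}
  | csucc x y => {x, y}
  | reg _ _ x y => {x, y}
  | neg φ => φ.freeVars
  | and φ ψ => φ.freeVars ∪ ψ.freeVars
  | ex x φ => φ.freeVars \ {x}

/-- Satisfaction in the data word `w`, with `X` interpreting the monadic predicates. Assignments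
are partial, since the empty data word has no positions; for a sentence the assignment is
irrelevant. -/
def Sat (w : List (A × D)) (X : Fin k → Set (Fin w.length)) :
    (Fin 2 → Option (Fin w.length)) → FO2 A k → Prop
  | ν, eq x y => ∃ i ∈ ν x, ∃ j ∈ ν y, i = j
  | ν, letter a x => ∃ i ∈ ν x, (w.get i).1 = a
  | ν, mon m x => ∃ i ∈ ν x, i ∈ X m
  | ν, lt x y => ∃ i ∈ ν x, ∃ j ∈ ν y, i < j
  | ν, succ x y => ∃ i ∈ ν x, ∃ j ∈ ν y, (i : ℕ) + 1 = (j : ℕ)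
  | ν, sim x y => ∃ i ∈ ν x, ∃ j ∈ ν y, DataWord.Sim w i j
  | ν, csucc x y => ∃ i ∈ ν x, ∃ j ∈ ν y, DataWord.ClassSucc w i j
  | ν, reg L _ x y => ∃ i ∈ ν x, ∃ j ∈ ν y, DataWord.Factor w X L i j
  | ν, neg φ => ¬ Sat w X ν φ
  | ν, and φ ψ => Sat w X ν φ ∧ Sat w X ν ψ
  | ν, ex x φ => ∃ i, Sat w X (Function.update ν x (some i)) φ

end FO2

/-- A sentence `∃ X₁ … ∃ Xₖ φ` of existential monadic second-order logic with `φ` a two-variable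
first-order sentence over the vocabulary of `FO2 A k`. -/
structure EMSO2 (A : Type*) where
  numSets : ℕ
  matrix : FO2 A numSets
  closed : matrix.freeVars = ∅

/-- The data language defined by a sentence. -/
def EMSO2.language {A : Type*} (ψ : EMSO2 A) (D : Type*) : Set (List (A × D)) :=
  {w | ∃ X : Fin ψ.numSets → Set (Fin w.length), ψ.matrix.Sat w X (fun _ => none)}

/-- The data language `L` is definable in two-variable existential monadic second-order logic with
regular predicates. -/
def DefinableInEMSO2 {A D : Type*} (L : Set (List (A × D))) : Prop :=
  ∃ ψ : EMSO2 A, ψ.language D = L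

/-! Automata and sentences are both compared with a third formalism, projections of class-regular
conditions (`IsClassRegular`). Over an auxiliary finite alphabet these conditions restrict the word
of letters, the factors between consecutive positions of one data class, and the first and last
letter of each class. Nondeterminism, existential set quantifiers and the projection play the same
role.

Automata. The sets matter only through the membership vector of each data value, and the vectors of
different values evolve independently: a transition applies one map to all of them, except for the
value being read. Hence, on words labelled by transitions, correctness of the tests is a regular
condition on the factors between consecutive occurrences of a value. Acceptance can be checked at
the last occurrence, once every position is also labelled by the vectors that the remaining
transitions send to acceptable ones (`mem_language_iff_classCond`). Conversely, a set automaton can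
guess the auxiliary letters and keep every value in the set named by its last letter and the state
of the factor automaton since then (`config`, `run_setAutomaton`).

Logic. Class-regular conditions quantify universally over two positions, and class successor and
regular predicates express their matrix (`holds_expandData_iff`, `exists_emso2`). Conversely, by
induction on formulas, the truth of a formula at two distinct positions of a suitably annotated word
depends only on their order, on whether their data values are equal and consecutive, equal and not
consecutive, or different, and on membership of the spanned factor in a regular language
(`described_sat`). The hard case is the quantifier (`Described.exists_snd`). Witnesses are sorted by
direction and kind. The existence of a witness to the right is read off from a label that obeys a
recurrence from one class position to the next (`kindSet_append`), so class-regular conditions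
enforce the label; the left side follows by reversal. -/

/-! ### Regular languages given by folds -/

namespace Language

universe u

variable {B : Type u}

/-- The language of the words with a given property. -/
def ofPred (P : List B → Prop) : Language B := {x | P x}

@[simp]
theorem mem_ofPred {P : List B → Prop} {x : List B} : x ∈ ofPred P ↔ P x := Iff.rfl

theorem IsRegular.of_mem_iff {L L' : Language B} (h : L.IsRegular) (hL : ∀ x, x ∈ L' ↔ x ∈ L) :
    L'.IsRegular := by
  have : L' = L := Set.ext hL
  rwa [this]

theorem isRegular_foldl {S : Type*} [Finite S] (step : S → B → S) (s₀ : S) (P : S → Prop) :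
    IsRegular (ofPred fun x => P (x.foldl step s₀)) := by
  have := Fintype.ofFinite S
  exact isRegular_iff.2 ⟨S, inferInstance, ⟨step, s₀, {s | P s}⟩, rfl⟩

theorem IsRegular.exists_foldl {L : Language B} (h : L.IsRegular) :
    ∃ (S : Type) (_ : Finite S) (step : S → B → S) (s₀ : S) (F : Set S),
      ∀ x, x ∈ L ↔ x.foldl step s₀ ∈ F := by
  obtain ⟨S, _, M, rfl⟩ := h
  exact ⟨S, inferInstance, M.step, M.start, M.accept, fun x => Iff.rfl⟩

theorem IsRegular.preimage_map {B' : Type*} {L : Language B} (h : L.IsRegular) (f : B' → B) :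
    IsRegular (ofPred fun x => x.map f ∈ L) := by
  obtain ⟨S, _, M, rfl⟩ := h
  have := Fintype.ofFinite S
  exact ⟨S, inferInstance, M.comap f, M.accepts_comap f⟩

theorem isRegular_forall_mem (P : B → Prop) :
    IsRegular (ofPred fun x : List B => ∀ b ∈ x, P b) := by
  have h := isRegular_foldl (fun (s : Prop) b => s ∧ P b) True (fun s => s)
  refine h.of_mem_iff fun x => ?_
  change (∀ b ∈ x, P b) ↔ x.foldl (fun (s : Prop) b => s ∧ P b) True
  induction x using List.reverseRecOn with
  | nil => simp
  | append_singleton x a ih => simp [← ih, or_imp, forall_and]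

theorem isRegular_setOf_const (P : Prop) : IsRegular (ofPred fun _ : List B => P) :=
  isRegular_foldl (fun (s : Unit) _ => s) () (fun _ => P)

theorem isRegular_head [Finite B] (P : Option B → Prop) :
    IsRegular (ofPred fun x : List B => P x.head?) := by
  refine (isRegular_foldl (fun (o : Option B) b => o.or (some b)) none P).of_mem_iff fun x => ?_
  have key : ∀ (x : List B) (o : Option B),
      x.foldl (fun (o : Option B) b => o.or (some b)) o = o.or x.head? := by
    intro x
    induction x with
    | nil => simp
    | cons a x ih => intro o; rw [List.foldl_cons, ih]; cases o <;> simp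
  rw [mem_ofPred, mem_ofPred, key, Option.none_or]

theorem isRegular_getLast [Finite B] (P : Option B → Prop) :
    IsRegular (ofPred fun x : List B => P x.getLast?) := by
  refine (isRegular_foldl (fun (_ : Option B) b => some b) none P).of_mem_iff fun x => ?_
  rcases List.eq_nil_or_concat x with rfl | ⟨v, b, rfl⟩ <;> simp

/-- Words `a v b` constrained through `a`, `b` and the result of a finite fold over `v`. -/
theorem isRegular_factor [Finite B] {S : Type*} [Finite S] (step : S → B → S) (s₀ : S)
    (Φ : B → S → B → Prop) :
    IsRegular (ofPred fun x => ∃ a v b, x = a :: (v ++ [b]) ∧ Φ a (v.foldl step s₀) b) := by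
  -- The state remembers the first letter and holds back the most recent one, so that the inner fold
  -- has consumed exactly the letters strictly between them.
  let st : Option (B × Option (S × B)) → B → Option (B × Option (S × B)) := fun o c =>
    match o with
    | none => some (c, none)
    | some (a, none) => some (a, some (s₀, c))
    | some (a, some (s, b)) => some (a, some (step s b, c))
  have key : ∀ (a : B) (v : List B) (b : B),
      (a :: (v ++ [b])).foldl st none = some (a, some (v.foldl step s₀, b)) := by
    intro a v
    induction v using List.reverseRecOn with
    | nil => intro b; rfl
    | append_singleton v c ih =>
      intro b
      have := ih c
      simp only [List.foldl_cons, List.foldl_append, List.foldl_nil] at this ⊢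
      rw [this]
  have h := isRegular_foldl st none
    (fun o => ∃ a s b, o = some (a, some (s, b)) ∧ Φ a s b)
  refine h.of_mem_iff fun x => ?_
  constructor
  · rintro ⟨a, v, b, rfl, hΦ⟩
    exact ⟨a, _, b, key a v b, hΦ⟩
  · rintro ⟨a, s, b, hx, hΦ⟩
    rcases x with _ | ⟨a', x⟩
    · simp at hx
    rcases List.eq_nil_or_concat x with rfl | ⟨v, b', rfl⟩
    · simp [st] at hx
    · rw [List.concat_eq_append, key] at hx
      simp only [Option.some.injEq, Prod.mk.injEq] at hx
      obtain ⟨rfl, rfl, rfl⟩ := hx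
      exact ⟨_, v, _, by simp, hΦ⟩

/-- First letter, interior and last letter are determined by the word, so the existential
quantifiers can be removed. -/
theorem cons_append_mem_factor {P : B → List B → B → Prop} {a b : B} {v : List B} :
    a :: (v ++ [b]) ∈ ofPred (fun x => ∃ a v b, x = a :: (v ++ [b]) ∧ P a v b) ↔ P a v b := by
  constructor
  · rintro ⟨a', v', b', h, h'⟩
    simp only [List.cons.injEq] at h
    obtain ⟨rfl, h⟩ := h
    obtain ⟨rfl, hb⟩ := List.append_inj' h rfl
    obtain rfl := List.singleton_inj.1 hb
    exact h'
  · intro h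
    exact ⟨a, v, b, rfl, h⟩

/-- Words in which every letter carries the value of a finite fold over the remaining suffix. -/
theorem isRegular_suffix {C : Type*} [Finite C] (get : B → C) (step : B → C → C) (c₀ : C) :
    IsRegular (ofPred fun x => ∀ u b v, x = u ++ b :: v → get b = v.foldr step c₀) := by
  classical
  -- Read from the right, the value of the suffix is a state that is already known when a letter is
  -- checked against it; `none` is the sink after a mismatch.
  rw [← isRegular_reverse_iff]
  let st : Option C → B → Option C := fun o b =>
    match o with
    | none => none
    | some c => if get b = c then some (step b c) else none
  have h := isRegular_foldl st (some c₀) (fun o => o ≠ none)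
  refine h.of_mem_iff fun x => ?_
  have key : ∀ x : List B,
      ((∀ u b v, x = u ++ b :: v → get b = v.foldr step c₀) →
        x.foldr (fun b o => st o b) (some c₀) = some (x.foldr step c₀)) ∧
      (x.foldr (fun b o => st o b) (some c₀) ≠ none →
        ∀ u b v, x = u ++ b :: v → get b = v.foldr step c₀) := by
    intro x
    induction x with
    | nil => simp
    | cons a x ih =>
      constructor
      · intro h
        have h1 := ih.1 fun u b v hx => h (a :: u) b v (by simp [hx])
        simp only [List.foldr_cons, h1, st]
        rw [if_pos (h [] a x rfl)]
      · intro h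
        have hx : x.foldr (fun b o => st o b) (some c₀) ≠ none := by
          intro h0
          apply h
          simp [List.foldr_cons, h0, st]
        have h2 := ih.2 hx
        have h1 := ih.1 h2
        intro u b v hu
        rcases u with _ | ⟨c, u⟩
        · simp only [List.nil_append, List.cons.injEq] at hu
          obtain ⟨rfl, rfl⟩ := hu
          by_contra hne
          apply h
          simp only [List.foldr_cons, h1, st]
          rw [if_neg hne]
        · simp only [List.cons_append, List.cons.injEq] at hu
          exact h2 u b v hu.2
  rw [mem_reverse]
  change _ ↔ x.foldl st (some c₀) ≠ none
  rw [← List.foldr_reverse]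
  constructor
  · intro h
    rw [(key _).1 h]
    simp
  · exact (key _).2

end Language

/-! ### Relabelling data words -/

section Relabel

variable {T T₁ T₂ T' D : Type*}

/-- Apply a map to the letters of a data word. -/
def relabel (f : T → T') (w : List (T × D)) : List (T' × D) := w.map (Prod.map f id)

@[simp] theorem relabel_nil (f : T → T') : relabel f ([] : List (T × D)) = [] := rfl

@[simp] theorem relabel_cons (f : T → T') (a : T) (d : D) (w : List (T × D)) :
    relabel f ((a, d) :: w) = (f a, d) :: relabel f w := rfl

@[simp] theorem relabel_append (f : T → T') (w z : List (T × D)) :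
    relabel f (w ++ z) = relabel f w ++ relabel f z := List.map_append

@[simp] theorem relabel_reverse (f : T → T') (w : List (T × D)) :
    relabel f w.reverse = (relabel f w).reverse := List.map_reverse

@[simp] theorem relabel_map_fst (f : T → T') (w : List (T × D)) :
    (relabel f w).map Prod.fst = (w.map Prod.fst).map f := by
  simp [relabel, Function.comp_def]

@[simp] theorem relabel_map_snd (f : T → T') (w : List (T × D)) :
    (relabel f w).map Prod.snd = w.map Prod.snd := by
  simp [relabel, Function.comp_def]

@[simp] theorem relabel_length (f : T → T') (w : List (T × D)) :
    (relabel f w).length = w.length := by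
  simp [relabel]

theorem relabel_relabel {T'' : Type*} (g : T' → T'') (f : T → T') (w : List (T × D)) :
    relabel g (relabel f w) = relabel (g ∘ f) w := by
  simp [relabel, Function.comp_def]

theorem relabel_id (w : List (T × D)) : relabel id w = w := by
  simp [relabel]

theorem relabel_eq_append {f : T → T'} {w : List (T × D)} {u z : List (T' × D)}
    (h : relabel f w = u ++ z) :
    ∃ u' z', w = u' ++ z' ∧ relabel f u' = u ∧ relabel f z' = z := by
  obtain ⟨u', z', h1, h2, h3⟩ := List.map_eq_append_iff.1 h
  exact ⟨u', z', h1, h2, h3⟩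

theorem relabel_eq_cons {f : T → T'} {w : List (T × D)} {a : T'} {d : D} {z : List (T' × D)}
    (h : relabel f w = (a, d) :: z) :
    ∃ a' z', w = (a', d) :: z' ∧ f a' = a ∧ relabel f z' = z := by
  obtain ⟨⟨a', d'⟩, z', h1, h2, h3⟩ := List.map_eq_cons_iff.1 h
  simp only [Prod.map_apply, id, Prod.mk.injEq] at h2
  obtain ⟨rfl, rfl⟩ := h2
  exact ⟨a', z', h1, rfl, h3⟩

/-- Equal projections force equal lengths and data values, so the two words can be zipped. -/
theorem exists_relabel_prod {π₁ : T₁ → T} {π₂ : T₂ → T} (w₁ : List (T₁ × D)) (w₂ : List (T₂ × D))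
    (h : relabel π₁ w₁ = relabel π₂ w₂) :
    ∃ w : List ((T₁ × T₂) × D), relabel Prod.fst w = w₁ ∧ relabel Prod.snd w = w₂ := by
  induction w₁ generalizing w₂ with
  | nil =>
    have : w₂ = [] := by simpa [relabel] using h.symm
    exact ⟨[], by simp [this]⟩
  | cons p w₁ ih =>
    obtain ⟨a, d⟩ := p
    obtain ⟨a', z', rfl, -, h3⟩ := relabel_eq_cons h.symm
    obtain ⟨w, rfl, rfl⟩ := ih z' h3.symm
    exact ⟨((a, a'), d) :: w, by simp⟩

/-- Split at the first occurrence of a data value. -/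
theorem exists_eq_append_first {w : List (T × D)} {d : D} (h : d ∈ w.map Prod.snd) :
    ∃ v b z, w = v ++ (b, d) :: z ∧ d ∉ v.map Prod.snd := by
  induction w with
  | nil => simp at h
  | cons p w ih =>
    obtain ⟨b, e⟩ := p
    by_cases hd : e = d
    · subst hd
      exact ⟨[], b, w, by simp⟩
    · have : d ∈ w.map Prod.snd := by
        simpa [Ne.symm hd] using h
      obtain ⟨v, c, z, rfl, hv⟩ := ih this
      refine ⟨(b, e) :: v, c, z, rfl, ?_⟩
      simpa [Ne.symm hd] using hv

/-- Split at the last occurrence of a data value. -/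
theorem exists_eq_append_last {w : List (T × D)} {d : D} (h : d ∈ w.map Prod.snd) :
    ∃ u b v, w = u ++ (b, d) :: v ∧ d ∉ v.map Prod.snd := by
  have h' : d ∈ w.reverse.map Prod.snd := by simpa using h
  obtain ⟨v, b, z, hw, hv⟩ := exists_eq_append_first h'
  refine ⟨z.reverse, b, v.reverse, ?_, by simpa using hv⟩
  rw [← List.reverse_reverse w, hw]
  simp

theorem eq_of_append_first {v v' z z' : List (T × D)} {b b' : T} {d : D}
    (hv : d ∉ v.map Prod.snd) (hv' : d ∉ v'.map Prod.snd)
    (h : v ++ (b, d) :: z = v' ++ (b', d) :: z') : v = v' ∧ b = b' ∧ z = z' := by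
  induction v generalizing v' with
  | nil =>
    rcases v' with _ | ⟨p, v'⟩
    · simpa using h
    · simp only [List.nil_append, List.cons_append, List.cons.injEq] at h
      simp [← h.1] at hv'
  | cons p v ih =>
    rcases v' with _ | ⟨p', v'⟩
    · simp only [List.nil_append, List.cons_append, List.cons.injEq] at h
      simp [h.1] at hv
    · simp only [List.cons_append, List.cons.injEq] at h
      have h1 := ih (v' := v') (fun hh => hv (by simp only [List.map_cons, List.mem_cons, hh, or_true]))
        (fun hh => hv' (by simp only [List.map_cons, List.mem_cons, hh, or_true])) h.2
      exact ⟨by rw [h.1, h1.1], h1.2⟩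

theorem eq_of_append_last {u u' v v' : List (T × D)} {b b' : T} {d : D}
    (hv : d ∉ v.map Prod.snd) (hv' : d ∉ v'.map Prod.snd)
    (h : u ++ (b, d) :: v = u' ++ (b', d) :: v') : u = u' ∧ b = b' ∧ v = v' := by
  have h2 := congrArg List.reverse h
  simp only [List.reverse_append, List.reverse_cons, List.append_assoc, List.singleton_append]
    at h2
  obtain ⟨h3, h4, h5⟩ := eq_of_append_first (by simpa using hv) (by simpa using hv') h2
  exact ⟨List.reverse_injective h5, h4, List.reverse_injective h3⟩

end Relabel

/-! ### Class-regular conditions -/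

/-- Conditions on data words: the word of letters lies in `whole`, every factor spanned by two
consecutive positions with the same data value has its letters in `link`, and the first and the
last letter of each data value are in `fst` and `lst`. -/
structure ClassCond (T : Type*) where
  whole : Language T
  link : Language T
  fst : Set T
  lst : Set T
  whole_regular : whole.IsRegular
  link_regular : link.IsRegular

namespace ClassCond

variable {T T' D : Type*}

/-- The data words that satisfy the conditions. -/
structure Holds (C : ClassCond T) (w : List (T × D)) : Prop where
  whole : w.map Prod.fst ∈ C.whole
  link : ∀ u a d v b z, w = u ++ (a, d) :: (v ++ (b, d) :: z) → d ∉ v.map Prod.snd →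
    a :: (v.map Prod.fst ++ [b]) ∈ C.link
  fst : ∀ u a d z, w = u ++ (a, d) :: z → d ∉ u.map Prod.snd → a ∈ C.fst
  lst : ∀ u a d z, w = u ++ (a, d) :: z → d ∉ z.map Prod.snd → a ∈ C.lst

/-- Conjunction of conditions. -/
def inter (C C' : ClassCond T) : ClassCond T where
  whole := C.whole ⊓ C'.whole
  link := C.link ⊓ C'.link
  fst := C.fst ∩ C'.fst
  lst := C.lst ∩ C'.lst
  whole_regular := C.whole_regular.inf C'.whole_regular
  link_regular := C.link_regular.inf C'.link_regular

theorem holds_inter {C C' : ClassCond T} {w : List (T × D)} :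
    (C.inter C').Holds w ↔ C.Holds w ∧ C'.Holds w := by
  constructor
  · intro h
    exact ⟨⟨h.whole.1, fun u a d v b z hw hd => (h.link u a d v b z hw hd).1,
        fun u a d z hw hd => (h.fst u a d z hw hd).1, fun u a d z hw hd => (h.lst u a d z hw hd).1⟩,
      ⟨h.whole.2, fun u a d v b z hw hd => (h.link u a d v b z hw hd).2,
        fun u a d z hw hd => (h.fst u a d z hw hd).2, fun u a d z hw hd => (h.lst u a d z hw hd).2⟩⟩
  · rintro ⟨h, h'⟩
    exact ⟨⟨h.whole, h'.whole⟩,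
      fun u a d v b z hw hd => ⟨h.link u a d v b z hw hd, h'.link u a d v b z hw hd⟩,
      fun u a d z hw hd => ⟨h.fst u a d z hw hd, h'.fst u a d z hw hd⟩,
      fun u a d z hw hd => ⟨h.lst u a d z hw hd, h'.lst u a d z hw hd⟩⟩

/-- Conditions on the image under a letter-to-letter map. -/
def comap (f : T' → T) (C : ClassCond T) : ClassCond T' where
  whole := .ofPred fun x => x.map f ∈ C.whole
  link := .ofPred fun x => x.map f ∈ C.link
  fst := f ⁻¹' C.fst
  lst := f ⁻¹' C.lst
  whole_regular := C.whole_regular.preimage_map f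
  link_regular := C.link_regular.preimage_map f

theorem holds_comap {f : T' → T} {C : ClassCond T} {w : List (T' × D)} :
    (C.comap f).Holds w ↔ C.Holds (relabel f w) := by
  constructor
  · intro h
    refine ⟨by rw [relabel_map_fst]; exact h.whole, ?_, ?_, ?_⟩
    · intro u a d v b z hw hd
      obtain ⟨u, y, rfl, rfl, h2⟩ := relabel_eq_append hw
      obtain ⟨a, y, rfl, rfl, h3⟩ := relabel_eq_cons h2
      obtain ⟨v, y, rfl, rfl, h4⟩ := relabel_eq_append h3
      obtain ⟨b, y, rfl, rfl, h5⟩ := relabel_eq_cons h4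
      simpa [comap] using h.link u a d v b y rfl (by simpa using hd)
    · intro u a d z hw hd
      obtain ⟨u, y, rfl, rfl, h2⟩ := relabel_eq_append hw
      obtain ⟨a, y, rfl, rfl, h3⟩ := relabel_eq_cons h2
      exact h.fst u a d y rfl (by simpa using hd)
    · intro u a d z hw hd
      obtain ⟨u, y, rfl, rfl, h2⟩ := relabel_eq_append hw
      obtain ⟨a, y, rfl, rfl, h3⟩ := relabel_eq_cons h2
      exact h.lst u a d y rfl (by subst h3; simpa using hd)
  · intro h
    refine ⟨by simpa [comap] using h.whole, ?_, ?_, ?_⟩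
    · rintro u a d v b z rfl hd
      simpa [comap] using h.link (relabel f u) (f a) d (relabel f v) (f b) (relabel f z)
        (by simp) (by simpa using hd)
    · rintro u a d z rfl hd
      exact h.fst (relabel f u) (f a) d (relabel f z) (by simp) (by simpa using hd)
    · rintro u a d z rfl hd
      exact h.lst (relabel f u) (f a) d (relabel f z) (by simp) (by simpa using hd)

/-- Conditions on the reversed word. -/
def reverse (C : ClassCond T) : ClassCond T where
  whole := C.whole.reverse
  link := C.link.reverse
  fst := C.lst
  lst := C.fst
  whole_regular := C.whole_regular.reverse
  link_regular := C.link_regular.reverse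

/-- Reversal keeps consecutive positions of a class consecutive and exchanges first and last
occurrences. -/
theorem Holds.reverse {C : ClassCond T} {w : List (T × D)} (h : C.Holds w) :
    C.reverse.Holds w.reverse := by
  refine ⟨?_, ?_, ?_, ?_⟩
  · simpa [ClassCond.reverse, Language.mem_reverse] using h.whole
  · intro u a d v b z hw hd
    have := h.link z.reverse b d v.reverse a u.reverse
      (by rw [← List.reverse_reverse w, hw]; simp) (by simpa using hd)
    simpa [ClassCond.reverse, Language.mem_reverse] using this
  · intro u a d z hw hd
    exact h.lst z.reverse a d u.reverse
      (by rw [← List.reverse_reverse w, hw]; simp) (by simpa using hd)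
  · intro u a d z hw hd
    exact h.fst z.reverse a d u.reverse
      (by rw [← List.reverse_reverse w, hw]; simp) (by simpa using hd)

theorem reverse_reverse (C : ClassCond T) : C.reverse.reverse = C := by
  cases C; simp [reverse]

theorem holds_reverse {C : ClassCond T} {w : List (T × D)} :
    C.reverse.Holds w ↔ C.Holds w.reverse :=
  ⟨fun h => by simpa [reverse_reverse] using h.reverse, fun h => by simpa using h.reverse⟩

/-- The condition that the word of letters is in a given regular language. -/
def ofWhole (R : Language T) (hR : R.IsRegular) : ClassCond T where
  whole := R
  link := .ofPred fun _ => True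
  fst := Set.univ
  lst := Set.univ
  whole_regular := hR
  link_regular := Language.isRegular_setOf_const True

theorem holds_ofWhole {R : Language T} {hR : R.IsRegular} {w : List (T × D)} :
    (ofWhole R hR).Holds w ↔ w.map Prod.fst ∈ R :=
  ⟨fun h => h.whole, fun h => ⟨h, fun _ _ _ _ _ _ _ _ => trivial, fun _ _ _ _ _ _ => trivial,
    fun _ _ _ _ _ _ => trivial⟩⟩

end ClassCond

/-- The data language `L` consists of the relabellings of the data words over some finite alphabet
that satisfy some class-regular conditions. -/
def IsClassRegular {A D : Type*} (L : Set (List (A × D))) : Prop :=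
  ∃ (n : ℕ) (π : Fin n → A) (C : ClassCond (Fin n)), ∀ w, w ∈ L ↔ ∃ w', C.Holds w' ∧ relabel π w' = w

/-- Frees the auxiliary alphabet from the form `Fin n`, which keeps the definition clear of universe
levels. -/
theorem isClassRegular_of_finite {A D T : Type*} [Finite T] {L : Set (List (A × D))} (π : T → A)
    (C : ClassCond T) (h : ∀ w, w ∈ L ↔ ∃ w', C.Holds w' ∧ relabel π w' = w) :
    IsClassRegular L := by
  obtain ⟨n, ⟨e⟩⟩ := Finite.exists_equiv_fin T
  refine ⟨n, π ∘ e.symm, C.comap e.symm, fun w => (h w).trans ⟨?_, ?_⟩⟩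
  · rintro ⟨w', hw', rfl⟩
    refine ⟨relabel e w', ?_, ?_⟩
    · rw [ClassCond.holds_comap, relabel_relabel]
      simpa [relabel_id] using hw'
    · rw [relabel_relabel, Function.comp_assoc]
      simp
  · rintro ⟨w', hw', rfl⟩
    exact ⟨relabel e.symm w', ClassCond.holds_comap.1 hw', relabel_relabel _ _ _⟩

/-! ### Class-regular data languages are accepted by set automata -/

namespace SetAutomaton

variable {Q Y A D : Type*}

theorem run_append_singleton {M : SetAutomaton Q Y A} {c c' : SetAutConfig Q Y D}
    {w : List (A × D)} {p : A × D} :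
    M.Run c (w ++ [p]) c' ↔ ∃ c₁, M.Run c w c₁ ∧ M.Step c₁ p c' := by
  induction w generalizing c with
  | nil => simp [Run]
  | cons q w ih =>
    simp only [List.cons_append, Run, ih]
    constructor
    · rintro ⟨c₁, h1, c₂, h2, h3⟩
      exact ⟨c₂, ⟨c₁, h1, h2⟩, h3⟩
    · rintro ⟨c₂, ⟨c₁, h1, h2⟩, h3⟩
      exact ⟨c₁, h1, c₂, h2, h3⟩

end SetAutomaton

namespace ClassCond

variable {T A D S R : Type*}

/-- The part of the conditions that concerns all prefixes. -/
structure Pre (C : ClassCond T) (w : List (T × D)) : Prop where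
  link : ∀ u a d v b z, w = u ++ (a, d) :: (v ++ (b, d) :: z) → d ∉ v.map Prod.snd →
    a :: (v.map Prod.fst ++ [b]) ∈ C.link
  fst : ∀ u a d z, w = u ++ (a, d) :: z → d ∉ u.map Prod.snd → a ∈ C.fst

/-- A new position only adds a condition relating it to the last earlier occurrence of its value, or
a first-letter condition if there is none. This is what an automaton can check on the fly; last
letters have to wait for the end of the word. -/
theorem pre_append_singleton {C : ClassCond T} {w : List (T × D)} {b : T} {d : D} :
    C.Pre (w ++ [(b, d)]) ↔ C.Pre w ∧ (d ∉ w.map Prod.snd → b ∈ C.fst) ∧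
      ∀ u a v, w = u ++ (a, d) :: v → d ∉ v.map Prod.snd →
        a :: (v.map Prod.fst ++ [b]) ∈ C.link := by
  constructor
  · intro h
    refine ⟨⟨?_, ?_⟩, ?_, ?_⟩
    · rintro u a e v c z rfl hd
      exact h.link u a e v c (z ++ [(b, d)]) (by simp) hd
    · rintro u a e z rfl hd
      exact h.fst u a e (z ++ [(b, d)]) (by simp) hd
    · intro hd
      exact h.fst w b d [] rfl hd
    · rintro u a v rfl hd
      exact h.link u a d v b [] (by simp) hd
  · rintro ⟨h, h1, h2⟩
    refine ⟨?_, ?_⟩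
    · intro u a e v c z hw hd
      rcases List.eq_nil_or_concat z with rfl | ⟨z, p, rfl⟩
      · have hw' : w ++ [(b, d)] = (u ++ (a, e) :: v) ++ [(c, e)] := by simpa using hw
        obtain ⟨rfl, hp⟩ := List.append_inj' hw' rfl
        simp only [List.cons.injEq, Prod.mk.injEq, and_true] at hp
        obtain ⟨rfl, rfl⟩ := hp
        exact h2 u a v rfl hd
      · have hw' : w ++ [(b, d)] = (u ++ (a, e) :: (v ++ (c, e) :: z)) ++ [p] := by simpa using hw
        obtain ⟨rfl, -⟩ := List.append_inj' hw' rfl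
        exact h.link u a e v c z rfl hd
    · intro u a e z hw hd
      rcases List.eq_nil_or_concat z with rfl | ⟨z, p, rfl⟩
      · obtain ⟨rfl, hp⟩ := List.append_inj' hw rfl
        simp only [List.cons.injEq, Prod.mk.injEq, and_true] at hp
        obtain ⟨rfl, rfl⟩ := hp
        exact h1 hd
      · have hw' : w ++ [(b, d)] = (u ++ (a, e) :: z) ++ [p] := by simpa using hw
        obtain ⟨rfl, -⟩ := List.append_inj' hw' rfl
        exact h.fst u a e z rfl hd

/-- The configuration in which every data value `d` is stored in the set named by its last letter
and the value of a fold over the letters since the last occurrence of `d`. -/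
def config (stR : R → T → R) (r₀ : R) (stK : S → T → S) (k₀ : S) (w : List (T × D)) :
    SetAutConfig R (T × S) D where
  state := (w.map Prod.fst).foldl stR r₀
  sets y := {d | ∃ u v, w = u ++ (y.1, d) :: v ∧ d ∉ v.map Prod.snd ∧
    (y.1 :: v.map Prod.fst).foldl stK k₀ = y.2}

section

variable (stR : R → T → R) (r₀ : R) (stK : S → T → S) (k₀ : S)

theorem charVec_config_of_notMem {w : List (T × D)} {d : D} (h : d ∉ w.map Prod.snd) :
    (config stR r₀ stK k₀ w).charVec d = ∅ := by
  ext y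
  simp only [SetAutConfig.charVec, config, Set.mem_ofPred_eq, Set.mem_empty_iff_false, iff_false]
  rintro ⟨u, v, rfl, -, -⟩
  simp at h

theorem charVec_config_append {u v : List (T × D)} {a : T} {d : D} (h : d ∉ v.map Prod.snd) :
    (config stR r₀ stK k₀ (u ++ (a, d) :: v)).charVec d =
      {(a, (a :: v.map Prod.fst).foldl stK k₀)} := by
  ext ⟨l, s⟩
  simp only [SetAutConfig.charVec, config, Set.mem_ofPred_eq, Set.mem_singleton_iff, Prod.mk.injEq]
  constructor
  · rintro ⟨u', v', hw, hv, hs⟩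
    obtain ⟨rfl, rfl, rfl⟩ := eq_of_append_last h hv hw
    exact ⟨rfl, hs.symm⟩
  · rintro ⟨rfl, rfl⟩
    exact ⟨u, v, rfl, h, rfl⟩

/-- The global update advances the fold for all values alike while keeping the last letter. For the
value read this is wrong, and the local update repairs it: the value enters the one set of a fresh
start at `b` and leaves all others. -/
theorem config_append_singleton_sets (w : List (T × D)) (b : T) (d : D) :
    (config stR r₀ stK k₀ (w ++ [(b, d)])).sets =
      SetAutomaton.localUpdate {(b, stK k₀ b)} {(b, stK k₀ b)}ᶜ d
        (SetAutomaton.globalUpdate {p | p.2 = (p.1.1, stK p.1.2 b)}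
          (config stR r₀ stK k₀ w).sets) := by
  funext ⟨l, s⟩
  ext e
  simp only [SetAutomaton.localUpdate, SetAutomaton.globalUpdate, config, Set.mem_ofPred_eq,
    Set.mem_sdiff, Set.mem_union, Set.mem_iUnion, Set.mem_compl_iff, Set.mem_singleton_iff,
    exists_prop, Prod.mk.injEq, Prod.exists]
  by_cases hed : e = d
  · subst hed
    constructor
    · rintro ⟨u, v, hw, hv, hs⟩
      obtain ⟨-, rfl, rfl⟩ := eq_of_append_last (by simp) hv hw
      simp only [List.map_nil, List.foldl_cons, List.foldl_nil] at hs
      exact ⟨Or.inr ⟨rfl, rfl, hs.symm⟩, fun h => h.2 ⟨rfl, hs.symm⟩⟩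
    · rintro ⟨-, h⟩
      simp only [true_and, not_not] at h
      obtain ⟨rfl, rfl⟩ := h
      exact ⟨w, [], rfl, by simp, rfl⟩
  · constructor
    · rintro ⟨u, v, hw, hv, hs⟩
      refine ⟨Or.inl ?_, fun h => hed h.1⟩
      rcases List.eq_nil_or_concat v with rfl | ⟨v, p, rfl⟩
      · obtain ⟨rfl, hp⟩ := List.append_inj' hw rfl
        simp only [List.cons.injEq, Prod.mk.injEq, and_true] at hp
        exact absurd hp.2.symm hed
      · have hw' : w ++ [(b, d)] = (u ++ (l, e) :: v) ++ [p] := by simpa using hw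
        obtain ⟨rfl, hp⟩ := List.append_inj' hw' rfl
        simp only [List.cons.injEq, and_true] at hp
        subst hp
        refine ⟨l, _, ⟨rfl, ?_⟩, u, v, rfl, ?_, rfl⟩
        · simpa using hs.symm
        · exact fun hh => hv (by simp only [List.concat_eq_append, List.map_append, List.mem_append, hh, true_or])
    · rintro ⟨h | h, -⟩
      · obtain ⟨l', s', ⟨rfl, rfl⟩, u, v, rfl, hv, rfl⟩ := h
        refine ⟨u, v ++ [(b, d)], by simp, ?_, by simp⟩
        rw [List.map_append, List.mem_append, not_or]
        exact ⟨hv, by simpa using hed⟩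
      · exact absurd h.1 hed

/-- A set automaton that runs the fold `stR` on the word and the fold `stK` on every class factor. -/
def setAutomaton (C : ClassCond T) (π : T → A) (accR : Set R) (accK : Set S) :
    SetAutomaton R (T × S) A where
  trans := {t | ∃ b, t.letter = π b ∧ t.tgt = stR t.src b ∧
    t.glob = {p | p.2 = (p.1.1, stK p.1.2 b)} ∧ t.add = {(b, stK k₀ b)} ∧
    t.rem = {(b, stK k₀ b)}ᶜ ∧
    ((t.test = ∅ ∧ b ∈ C.fst) ∨ ∃ l s, t.test = {(l, s)} ∧ stK s b ∈ accK)}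
  init := {r₀}
  final := accR
  acc := {z | ∃ l s, z = {(l, s)} ∧ l ∈ C.lst}

variable {stR r₀ stK k₀} {C : ClassCond T} {π : T → A} {accR : Set R} {accK : Set S}

/-- The transition guesses the auxiliary letter `b`. An empty membership vector reveals a first
occurrence; otherwise the vector is a singleton holding the fold up to `b`, which decides the factor
condition. -/
theorem step_setAutomaton (hK : ∀ x, x ∈ C.link ↔ x.foldl stK k₀ ∈ accK) {w : List (T × D)}
    {p : A × D} {c : SetAutConfig R (T × S) D} :
    (setAutomaton stR r₀ stK k₀ C π accR accK).Step (config stR r₀ stK k₀ w) p c ↔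
      ∃ b, π b = p.1 ∧ ((p.2 ∉ w.map Prod.snd → b ∈ C.fst) ∧
        ∀ u a v, w = u ++ (a, p.2) :: v → p.2 ∉ v.map Prod.snd →
          a :: (v.map Prod.fst ++ [b]) ∈ C.link) ∧
        c = config stR r₀ stK k₀ (w ++ [(b, p.2)]) := by
  obtain ⟨a, d⟩ := p
  constructor
  · rintro ⟨t, ⟨b, h1, h2, h3, h4, h5, h6⟩, h7, h8, h9, h10, h11⟩
    refine ⟨b, h1.symm.trans h8, ⟨?_, ?_⟩, ?_⟩
    · intro hd
      dsimp only at hd h9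
      rw [charVec_config_of_notMem stR r₀ stK k₀ hd] at h9
      rcases h6 with h6 | ⟨l, s, h6, -⟩
      · exact h6.2
      · rw [h6] at h9
        exact absurd h9 (Set.singleton_ne_empty _)
    · rintro u l v rfl hv
      dsimp only at hv h9
      rw [charVec_config_append stR r₀ stK k₀ hv] at h9
      rcases h6 with ⟨h6, -⟩ | ⟨l', s, h6, hs⟩
      · rw [h6] at h9
        exact absurd h9.symm (Set.singleton_ne_empty _)
      · rw [h6, Set.singleton_eq_singleton_iff, Prod.mk.injEq] at h9
        obtain ⟨rfl, rfl⟩ := h9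
        rw [hK]
        simpa using hs
    · cases c with
      | mk q X =>
        dsimp only at h10 h11
        have e1 : q = (config stR r₀ stK k₀ (w ++ [(b, d)])).state := by
          rw [h10, h2, h7]; simp [config]
        have e2 : X = (config stR r₀ stK k₀ (w ++ [(b, d)])).sets := by
          rw [h11, h3, h4, h5, config_append_singleton_sets]
        rw [e1, e2]
  · rintro ⟨b, h1, ⟨h2, h3⟩, rfl⟩
    dsimp only at h1 h2 h3
    refine ⟨⟨(config stR r₀ stK k₀ w).state, a, (config stR r₀ stK k₀ w).charVec d,
      {p | p.2 = (p.1.1, stK p.1.2 b)}, {(b, stK k₀ b)}, {(b, stK k₀ b)}ᶜ,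
      stR (config stR r₀ stK k₀ w).state b⟩, ⟨b, h1.symm, rfl, rfl, rfl, rfl, ?_⟩, rfl, rfl, rfl,
      ?_, ?_⟩
    · by_cases hd : d ∈ w.map Prod.snd
      · obtain ⟨u, l, v, rfl, hv⟩ := exists_eq_append_last hd
        right
        refine ⟨l, _, charVec_config_append stR r₀ stK k₀ hv, ?_⟩
        have := (hK _).1 (h3 u l v rfl hv)
        simpa using this
      · exact Or.inl ⟨charVec_config_of_notMem stR r₀ stK k₀ hd, h2 hd⟩
    · simp [config]
    · exact config_append_singleton_sets stR r₀ stK k₀ w b d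

theorem run_setAutomaton (hK : ∀ x, x ∈ C.link ↔ x.foldl stK k₀ ∈ accK) {w : List (A × D)}
    {c : SetAutConfig R (T × S) D} :
    (setAutomaton stR r₀ stK k₀ C π accR accK).Run (config stR r₀ stK k₀ []) w c ↔
      ∃ w', relabel π w' = w ∧ C.Pre w' ∧ c = config stR r₀ stK k₀ w' := by
  induction w using List.reverseRecOn generalizing c with
  | nil =>
    constructor
    · intro h
      exact ⟨[], rfl, ⟨by simp, by simp⟩, Eq.symm h⟩
    · rintro ⟨w', h1, -, rfl⟩
      have : w' = [] := by simpa [relabel] using h1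
      subst this
      rfl
  | append_singleton w p ih =>
    rw [SetAutomaton.run_append_singleton]
    constructor
    · rintro ⟨c₁, h1, h2⟩
      obtain ⟨w', rfl, hw', rfl⟩ := ih.1 h1
      obtain ⟨b, hb, h3, rfl⟩ := (step_setAutomaton hK).1 h2
      refine ⟨w' ++ [(b, p.2)], by simp [hb], pre_append_singleton.2 ⟨hw', h3⟩, rfl⟩
    · rintro ⟨w', h1, h2, rfl⟩
      obtain ⟨u, z, rfl, rfl, h3⟩ := relabel_eq_append h1
      obtain ⟨b, z, rfl, hb, h4⟩ := relabel_eq_cons (d := p.2) (a := p.1) h3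
      have : z = [] := by simpa [relabel] using h4
      subst this
      obtain ⟨h5, h6⟩ := pre_append_singleton.1 h2
      exact ⟨_, ih.2 ⟨u, rfl, h5, rfl⟩, (step_setAutomaton hK).2 ⟨b, hb, h6, rfl⟩⟩

end

end ClassCond

theorem IsClassRegular.acceptedBySetAutomaton {A D : Type*} {L : Set (List (A × D))}
    (h : IsClassRegular L) : AcceptedBySetAutomaton L := by
  obtain ⟨n, π, C, hL⟩ := h
  obtain ⟨R, _, stR, r₀, accR, hR⟩ := C.whole_regular.exists_foldl
  obtain ⟨S, _, stK, k₀, accK, hK⟩ := C.link_regular.exists_foldl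
  refine ⟨R, Fin n × S, inferInstance, inferInstance,
    ClassCond.setAutomaton stR r₀ stK k₀ C π accR accK, ?_⟩
  ext w
  rw [hL]
  have hinit : ∀ c : SetAutConfig R (Fin n × S) D,
      (ClassCond.setAutomaton stR r₀ stK k₀ C π accR accK).IsInitial c ↔
        c = ClassCond.config stR r₀ stK k₀ [] := by
    rintro ⟨q, X⟩
    simp [SetAutomaton.IsInitial, ClassCond.setAutomaton, ClassCond.config, funext_iff]
  constructor
  · rintro ⟨c, c', h1, h2, h3, h4⟩
    rw [(hinit c).1 h1, ClassCond.run_setAutomaton hK] at h2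
    obtain ⟨w', rfl, hw', rfl⟩ := h2
    refine ⟨w', ⟨(hR _).2 h3, hw'.link, hw'.fst, ?_⟩, rfl⟩
    rintro u a d v rfl hv
    have hc := ClassCond.charVec_config_append stR r₀ stK k₀ (u := u) (a := a) hv
    have hm : (a, (a :: v.map Prod.fst).foldl stK k₀) ∈
        (ClassCond.config stR r₀ stK k₀ (u ++ (a, d) :: v)).charVec d := by
      rw [hc]
      exact Set.mem_singleton _
    obtain ⟨l, s, h5, h6⟩ := h4 d ⟨_, hm⟩
    rw [hc, Set.singleton_eq_singleton_iff, Prod.mk.injEq] at h5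
    rw [h5.1]
    exact h6
  · rintro ⟨w', hw', rfl⟩
    refine ⟨_, _, (hinit _).2 rfl,
      (ClassCond.run_setAutomaton hK).2 ⟨w', rfl, ⟨hw'.link, hw'.fst⟩, rfl⟩,
      (hR _).1 hw'.whole, ?_⟩
    -- A value lies in a set only if it occurs, and the name of that set records its last letter; so
    -- the accepting vectors test exactly `C.lst`.
    rintro d ⟨y, hy⟩
    obtain ⟨u, v, rfl, hv, -⟩ := hy
    exact ⟨_, _, ClassCond.charVec_config_append stR r₀ stK k₀ hv, hw'.lst u y.1 d v rfl hv⟩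

/-! ### Languages of set automata are class-regular -/

section Annotate

variable {T D Λ : Type*}

/-- Labels may depend on the whole suffix, as they can be computed from right to left. -/
theorem exists_annotate (ℓ : T → D → List (T × D) → Λ) (w : List (T × D)) :
    ∃ w' : List ((T × Λ) × D), relabel Prod.fst w' = w ∧
      ∀ u a d z, w' = u ++ (a, d) :: z → a.2 = ℓ a.1 d (relabel Prod.fst z) := by
  induction w with
  | nil => exact ⟨[], by simp⟩
  | cons p w ih =>
    obtain ⟨w', rfl, hw'⟩ := ih
    refine ⟨((p.1, ℓ p.1 p.2 (relabel Prod.fst w')), p.2) :: w', by simp, ?_⟩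
    rintro (_ | ⟨q, u⟩) a d z h
    · simp only [List.nil_append, List.cons.injEq, Prod.mk.injEq] at h
      obtain ⟨⟨rfl, rfl⟩, rfl⟩ := h
      rfl
    · simp only [List.cons_append, List.cons.injEq] at h
      exact hw' u a d z h.2

/-- A fold from an unknown start state is itself a fold whose states are functions; for a finite
state set there are finitely many of these. -/
theorem foldl_comp {S B : Type*} (step : S → B → S) (v : List B) (f : S → S) (s : S) :
    v.foldl (fun g b => fun s => step (g s) b) f s = v.foldl step (f s) := by
  induction v generalizing f with
  | nil => rfl
  | cons b v ih => rw [List.foldl_cons, List.foldl_cons, ih]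

end Annotate

/-! ### Evolution of the membership vector of a single data value -/

namespace SetAutTransition

variable {Q Y A D : Type*}

instance [Finite Q] [Finite Y] [Finite A] : Finite (SetAutTransition Q Y A) :=
  Finite.of_injective (fun t => (t.src, t.letter, t.test, t.glob, t.add, t.rem, t.tgt)) (by
    rintro ⟨⟩ ⟨⟩ h
    simp only [Prod.mk.injEq] at h
    simpa using h)

/-- The new membership vector of a value that is not read. -/
def shift (t : SetAutTransition Q Y A) (z : Set Y) : Set Y := {y | ∃ x ∈ z, (x, y) ∈ t.glob}

/-- The new membership vector of the value that is read. -/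
def update (t : SetAutTransition Q Y A) (z : Set Y) : Set Y := (t.shift z ∪ t.add) \ t.rem

open Classical in
/-- The new membership vector of the value `d`. -/
noncomputable def vecStep (d : D) (z : Set Y) (p : SetAutTransition Q Y A × D) : Set Y :=
  if p.2 = d then p.1.update z else p.1.shift z

theorem shift_empty (t : SetAutTransition Q Y A) : t.shift ∅ = ∅ := by
  simp [shift]

/-- Between two occurrences of a value its vector depends on the transitions alone. This is why
tests become conditions on the letters of class factors. -/
theorem foldl_vecStep_of_notMem {d : D} {v : List (SetAutTransition Q Y A × D)}
    (h : d ∉ v.map Prod.snd) (z : Set Y) :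
    v.foldl (vecStep d) z = (v.map Prod.fst).foldl (fun z t => t.shift z) z := by
  induction v generalizing z with
  | nil => rfl
  | cons p v ih =>
    simp only [List.map_cons, List.mem_cons, not_or] at h
    simp only [List.foldl_cons, List.map_cons]
    rw [ih h.2, vecStep, if_neg (Ne.symm h.1)]

theorem foldl_shift_empty (v : List (SetAutTransition Q Y A)) :
    v.foldl (fun z t => t.shift z) ∅ = ∅ := by
  induction v with
  | nil => rfl
  | cons p v ih => rw [List.foldl_cons, shift_empty, ih]

theorem foldl_vecStep_append {d : D} {t : SetAutTransition Q Y A}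
    {u v : List (SetAutTransition Q Y A × D)} (h : d ∉ v.map Prod.snd) (z : Set Y) :
    (u ++ (t, d) :: v).foldl (vecStep d) z =
      (v.map Prod.fst).foldl (fun z t => t.shift z) (t.update (u.foldl (vecStep d) z)) := by
  rw [List.foldl_append, List.foldl_cons, foldl_vecStep_of_notMem h, vecStep, if_pos rfl]

/-- Global and local updates act on each data value separately, so a configuration may be replaced
by a family of independent vectors. -/
theorem charVec_update (t : SetAutTransition Q Y A) (q q' : Q) (X : Y → Set D) (e d : D) :
    SetAutConfig.charVec (⟨q, SetAutomaton.localUpdate t.add t.rem e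
      (SetAutomaton.globalUpdate t.glob X)⟩ : SetAutConfig Q Y D) d =
      vecStep d (SetAutConfig.charVec ⟨q', X⟩ d) (t, e) := by
  ext y
  by_cases h : e = d
  · subst h
    simp [SetAutConfig.charVec, SetAutomaton.localUpdate, SetAutomaton.globalUpdate, vecStep,
      update, shift, and_comm]
  · simp [SetAutConfig.charVec, SetAutomaton.localUpdate, SetAutomaton.globalUpdate, vecStep,
      shift, h, Ne.symm h, and_comm]

end SetAutTransition

namespace SetAutomaton

variable {Q Y A D : Type*}

open SetAutTransition

theorem _root_.SetAutConfig.ext_charVec {c c' : SetAutConfig Q Y D} (h : c.state = c'.state)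
    (h' : ∀ d, c.charVec d = c'.charVec d) : c = c' := by
  obtain ⟨q, X⟩ := c
  obtain ⟨q', X'⟩ := c'
  obtain rfl : q = q' := h
  congr 1
  funext y
  ext d
  exact Set.ext_iff.1 (h' d) y

/-- The set of states that can be reached from a set of states by a transition. -/
def pathStep (M : SetAutomaton Q Y A) (P : Set Q) (t : SetAutTransition Q Y A) : Set Q :=
  {q | t ∈ M.trans ∧ t.src ∈ P ∧ q = t.tgt}

theorem step_iff {M : SetAutomaton Q Y A} {c c' : SetAutConfig Q Y D} {p : A × D} :
    M.Step c p c' ↔ ∃ t ∈ M.trans, t.src = c.state ∧ t.letter = p.1 ∧ t.test = c.charVec p.2 ∧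
      c'.state = t.tgt ∧ ∀ d, c'.charVec d = vecStep d (c.charVec d) (t, p.2) := by
  obtain ⟨q, X⟩ := c
  obtain ⟨q', X'⟩ := c'
  unfold Step
  refine exists_congr fun t => and_congr_right fun _ => and_congr_right fun _ =>
    and_congr_right fun _ => and_congr_right fun _ => and_congr_right fun h => ?_
  constructor
  · intro h d
    dsimp only at h
    subst h
    exact charVec_update t q' q X p.2 d
  · intro h
    have : (⟨q', X'⟩ : SetAutConfig Q Y D) =
        ⟨q', localUpdate t.add t.rem p.2 (globalUpdate t.glob X)⟩ := SetAutConfig.ext_charVec rfl fun d =>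
      (h d).trans (charVec_update t q' q X p.2 d).symm
    exact congrArg SetAutConfig.sets this

/-- Eliminates configurations: a run is a sequence of transitions that forms a path of states and
whose tests agree with the vectors computed from the prefixes. -/
theorem exists_run_iff {M : SetAutomaton Q Y A} {w : List (A × D)} {c' : SetAutConfig Q Y D} :
    (∃ c, M.IsInitial c ∧ M.Run c w c') ↔ ∃ ts : List (SetAutTransition Q Y A × D),
      relabel letter ts = w ∧ c'.state ∈ (ts.map Prod.fst).foldl M.pathStep M.init ∧
      (∀ u t d z, ts = u ++ (t, d) :: z → t.test = u.foldl (vecStep d) ∅) ∧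
      ∀ d, c'.charVec d = ts.foldl (vecStep d) ∅ := by
  induction w using List.reverseRecOn generalizing c' with
  | nil =>
    constructor
    · rintro ⟨c, ⟨h1, h2⟩, rfl⟩
      exact ⟨[], rfl, h1, by simp, fun d => by simp [SetAutConfig.charVec, h2]⟩
    · rintro ⟨ts, h1, h2, -, h3⟩
      obtain rfl : ts = [] := by simpa [relabel] using h1
      refine ⟨c', ⟨h2, fun y => ?_⟩, rfl⟩
      ext d
      exact Set.ext_iff.1 (h3 d) y
  | append_singleton w p ih =>
    obtain ⟨a, d⟩ := p
    have e1 : (∃ c, M.IsInitial c ∧ M.Run c (w ++ [(a, d)]) c') ↔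
        ∃ c₁, (∃ c, M.IsInitial c ∧ M.Run c w c₁) ∧ M.Step c₁ (a, d) c' := by
      constructor
      · rintro ⟨c, h1, h2⟩
        obtain ⟨c₁, h3, h4⟩ := run_append_singleton.1 h2
        exact ⟨c₁, ⟨c, h1, h3⟩, h4⟩
      · rintro ⟨c₁, ⟨c, h1, h3⟩, h4⟩
        exact ⟨c, h1, run_append_singleton.2 ⟨c₁, h3, h4⟩⟩
    rw [e1]
    constructor
    · rintro ⟨c₁, h1, h2⟩
      obtain ⟨ts, rfl, h3, h4, h5⟩ := ih.1 h1
      obtain ⟨t, h6, h7, rfl, h9, h10, h11⟩ := step_iff.1 h2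
      refine ⟨ts ++ [(t, d)], by simp, ?_, ?_, ?_⟩
      · simp only [List.map_append, List.foldl_append, List.map_cons, List.map_nil,
          List.foldl_cons, List.foldl_nil]
        exact ⟨h6, h7 ▸ h3, h10⟩
      · intro u t' e z hw
        rcases List.eq_nil_or_concat z with rfl | ⟨z, p, rfl⟩
        · obtain ⟨rfl, hp⟩ := List.append_inj' hw rfl
          simp only [List.cons.injEq, Prod.mk.injEq, and_true] at hp
          obtain ⟨rfl, rfl⟩ := hp
          exact h9.trans (h5 d)
        · have hw' : ts ++ [(t, d)] = (u ++ (t', e) :: z) ++ [p] := by simpa using hw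
          obtain ⟨rfl, -⟩ := List.append_inj' hw' rfl
          exact h4 u t' e z rfl
      · intro e
        rw [h11, h5, List.foldl_append]
        rfl
    · rintro ⟨ts', h1, h2, h3, h4⟩
      obtain ⟨ts, z, rfl, rfl, h5⟩ := relabel_eq_append h1
      obtain ⟨t, z, rfl, rfl, h6⟩ := relabel_eq_cons h5
      obtain rfl : z = [] := by simpa [relabel] using h6
      simp only [List.map_append, List.foldl_append, List.map_cons, List.map_nil,
          List.foldl_cons, List.foldl_nil] at h2
      obtain ⟨h7, h8, h9⟩ := h2
      -- The configuration before the last step is rebuilt from the source of the last transition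
      -- and the vectors of the prefix.
      let c₁ : SetAutConfig Q Y D := ⟨t.src, fun y => {d | y ∈ ts.foldl (vecStep d) ∅}⟩
      have hc₁ : ∀ d, c₁.charVec d = ts.foldl (vecStep d) ∅ := fun d => rfl
      refine ⟨c₁, ih.2 ⟨ts, rfl, h8, fun u t' e z hts => ?_, hc₁⟩,
        step_iff.2 ⟨t, h7, rfl, rfl, ?_, h9, ?_⟩⟩
      · exact h3 u t' e (z ++ [(t, d)]) (by simp [hts])
      · rw [hc₁]
        exact h3 ts t d [] rfl
      · intro e
        rw [h4, hc₁, List.foldl_append]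
        rfl

/-- The vectors from which a sequence of transitions leads to an acceptable vector. -/
def good (M : SetAutomaton Q Y A) (v : List (SetAutTransition Q Y A)) : Set (Set Y) :=
  v.foldr (fun t G => {z | t.shift z ∈ G}) {z | z = ∅ ∨ z ∈ M.acc}

theorem mem_good {M : SetAutomaton Q Y A} {v : List (SetAutTransition Q Y A)} {z : Set Y} :
    z ∈ M.good v ↔
      v.foldl (fun z t => t.shift z) z = ∅ ∨ v.foldl (fun z t => t.shift z) z ∈ M.acc := by
  induction v generalizing z with
  | nil => rfl
  | cons t v ih => exact ih

/-- Conditions on a data word labelled by transitions and by the sets `good` of the suffixes that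
express that the transitions form an accepting run. -/
def classCond [Finite Q] [Finite Y] [Finite A] (M : SetAutomaton Q Y A) :
    ClassCond (SetAutTransition Q Y A × Set (Set Y)) where
  whole := .ofPred (fun x => ∃ q ∈ M.final, q ∈ (x.map Prod.fst).foldl M.pathStep M.init) ⊓
    .ofPred fun x => ∀ u b v, x = u ++ b :: v → b.2 = M.good (v.map Prod.fst)
  link := .ofPred fun x => ∃ a v b, x = a :: (v ++ [b]) ∧
    b.1.test = (v.map Prod.fst).foldl (fun z t => t.shift z) (a.1.update a.1.test)
  fst := {a | a.1.test = ∅}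
  lst := {a | a.1.update a.1.test ∈ a.2}
  whole_regular := by
    refine Language.IsRegular.inf ?_ ?_
    · exact (Language.isRegular_foldl M.pathStep M.init
        (fun P => ∃ q ∈ M.final, q ∈ P)).preimage_map Prod.fst
    · refine (Language.isRegular_suffix
        (B := SetAutTransition Q Y A × Set (Set Y)) (C := Set (Set Y)) (fun b => b.2)
        (fun b G => {z | b.1.shift z ∈ G}) {z | z = ∅ ∨ z ∈ M.acc}).of_mem_iff fun x => ?_
      simp only [Language.mem_ofPred, good, List.foldr_map]
  link_regular := by
    refine (Language.isRegular_factor (B := SetAutTransition Q Y A × Set (Set Y))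
      (S := Set Y → Set Y) (fun f b z => b.1.shift (f z)) id
      (fun a f b => b.1.test = f (a.1.update a.1.test))).of_mem_iff fun x => ?_
    refine exists_congr fun a => exists_congr fun v => exists_congr fun b =>
      and_congr_right fun _ => ?_
    rw [List.foldl_map, foldl_comp (fun z (b : SetAutTransition Q Y A × Set (Set Y)) => b.1.shift z)]
    rfl

theorem mem_link_classCond [Finite Q] [Finite Y] [Finite A] {M : SetAutomaton Q Y A}
    {a b : SetAutTransition Q Y A × Set (Set Y)} {v : List (SetAutTransition Q Y A × Set (Set Y))} :
    a :: (v ++ [b]) ∈ M.classCond.link ↔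
      b.1.test = (v.map Prod.fst).foldl (fun z t => t.shift z) (a.1.update a.1.test) :=
  Language.cons_append_mem_factor (P := fun (a : SetAutTransition Q Y A × Set (Set Y))
    (v : List (SetAutTransition Q Y A × Set (Set Y))) b =>
    b.1.test = (v.map Prod.fst).foldl (fun z t => t.shift z) (a.1.update a.1.test))

/-- The link condition propagates the correctness of tests from one occurrence of a value to the
next. At the last occurrence the label `good` tells whether the final vector will be acceptable; the
empty vector always is, since acceptance concerns only stored values. -/
theorem mem_language_iff_classCond [Finite Q] [Finite Y] [Finite A] {M : SetAutomaton Q Y A}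
    {w : List (A × D)} : w ∈ M.language D ↔
      ∃ w', M.classCond.Holds w' ∧ relabel (fun b => b.1.letter) w' = w := by
  constructor
  · rintro ⟨c, c', h1, h2, h3, h4⟩
    obtain ⟨ts, rfl, h5, h6, h7⟩ := exists_run_iff.1 ⟨c, h1, h2⟩
    obtain ⟨w', rfl, hw'⟩ := exists_annotate (fun _ _ z => M.good (z.map Prod.fst)) ts
    have h6' : ∀ u a d z, w' = u ++ (a, d) :: z →
        a.1.test = (relabel Prod.fst u).foldl (vecStep d) ∅ := by
      rintro u a d z rfl
      exact h6 (relabel Prod.fst u) a.1 d (relabel Prod.fst z) (by simp)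
    refine ⟨w', ⟨⟨⟨_, h3, by rw [relabel_map_fst] at h5; exact h5⟩, ?_⟩, ?_, ?_, ?_⟩,
      (relabel_relabel _ _ _).symm⟩
    · intro u b v hx
      obtain ⟨u, z, rfl, rfl, hz⟩ := List.map_eq_append_iff.1 hx
      obtain ⟨⟨b, d⟩, z, rfl, rfl, rfl⟩ := List.map_eq_cons_iff.1 hz
      simpa using hw' u b d z rfl
    · rintro u a d v b z hw hd
      rw [mem_link_classCond, h6' (u ++ (a, d) :: v) b d z (by simp [hw]), relabel_append,
        relabel_cons, foldl_vecStep_append (by simpa using hd), h6' u a d _ hw, relabel_map_fst]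
    · rintro u a d z hw hd
      change a.1.test = ∅
      rw [h6' u a d z hw, foldl_vecStep_of_notMem (by simpa using hd), foldl_shift_empty]
    · rintro u a d z hw hd
      change a.1.update a.1.test ∈ a.2
      rw [hw' u a d z hw, mem_good, h6' u a d z hw,
        ← foldl_vecStep_append (by simpa using hd), ← relabel_cons, ← relabel_append, ← hw, ← h7]
      by_contra hne
      rw [not_or] at hne
      exact hne.2 (h4 d (Set.nonempty_iff_ne_empty.2 hne.1))
  · rintro ⟨w', h, rfl⟩
    obtain ⟨⟨⟨q, hq, hq'⟩, hgood⟩, hlink, hfst, hlst⟩ := h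
    -- Strong induction on the position, because the previous occurrence of `d` may lie arbitrarily
    -- far back.
    have key : ∀ (n : ℕ) (u : List _), u.length = n → ∀ a d z, w' = u ++ (a, d) :: z →
        a.1.test = (relabel Prod.fst u).foldl (vecStep d) ∅ := by
      intro n
      induction n using Nat.strong_induction_on with
      | _ n ih =>
        intro u hn a d z hw
        by_cases hd : d ∈ u.map Prod.snd
        · obtain ⟨u, b, v, rfl, hv⟩ := exists_eq_append_last hd
          have h1 := ih u.length (by simp [← hn]) u rfl b d (v ++ (a, d) :: z)
            (by simp [hw])
          have h2 := mem_link_classCond.1 (hlink u b d v a z (by simp [hw]) hv)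
          rw [h2, h1, relabel_append, relabel_cons, foldl_vecStep_append (by simpa using hv),
            relabel_map_fst]
        · rw [foldl_vecStep_of_notMem (by simpa using hd), foldl_shift_empty]
          exact hfst u a d z hw hd
    have htest : ∀ u t d z, relabel Prod.fst w' = u ++ (t, d) :: z →
        t.test = u.foldl (vecStep d) ∅ := by
      intro u t d z hu
      obtain ⟨u, z, hw, rfl, h2⟩ := relabel_eq_append hu
      obtain ⟨a, z, rfl, rfl, h3⟩ := relabel_eq_cons h2
      exact key _ u rfl a d z hw
    let c' : SetAutConfig Q Y D :=
      ⟨q, fun y => {d | y ∈ (relabel Prod.fst w').foldl (vecStep d) ∅}⟩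
    have hc' : ∀ d, c'.charVec d = (relabel Prod.fst w').foldl (vecStep d) ∅ := fun d => rfl
    obtain ⟨c, h1, h2⟩ := (exists_run_iff (M := M) (c' := c')
      (w := relabel (fun b => b.1.letter) w')).2 ⟨relabel Prod.fst w', relabel_relabel _ _ _,
        by rw [relabel_map_fst]; exact hq', htest, hc'⟩
    · refine ⟨c, c', h1, h2, hq, ?_⟩
      intro d hd
      have hd' : c'.charVec d ≠ ∅ := Set.nonempty_iff_ne_empty.1 hd
      rw [hc'] at hd' ⊢
      by_cases hmem : d ∈ w'.map Prod.snd
      · obtain ⟨u, a, v, hw, hv⟩ := exists_eq_append_last hmem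
        have h3 := hlst u a d v hw hv
        have h4 := hgood (u.map Prod.fst) a (v.map Prod.fst) (by simp [hw])
        change a.1.update a.1.test ∈ a.2 at h3
        rw [h4, mem_good, key _ u rfl a d v hw, ← relabel_map_fst,
          ← foldl_vecStep_append (by simpa using hv), ← relabel_cons, ← relabel_append, ← hw] at h3
        exact h3.resolve_left hd'
      -- A value that is never read stays outside all sets.
      · exact absurd (by rw [foldl_vecStep_of_notMem (by simpa using hmem), foldl_shift_empty]) hd'

end SetAutomaton

theorem AcceptedBySetAutomaton.isClassRegular {A D : Type*} [Finite A] {L : Set (List (A × D))}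
    (h : AcceptedBySetAutomaton L) : IsClassRegular L := by
  obtain ⟨Q, Y, _, _, M, rfl⟩ := h
  exact isClassRegular_of_finite _ _ fun w => SetAutomaton.mem_language_iff_classCond

/-! ### Positions of data words -/

namespace DataWord

variable {A D : Type*} {k : ℕ}

theorem exists_split {T : Type*} (w : List T) {i : ℕ} (hi : i < w.length) :
    ∃ u p z, w = u ++ p :: z ∧ u.length = i :=
  ⟨w.take i, w[i], w.drop (i + 1), by simp, by simp; omega⟩

theorem exists_split₂ {T : Type*} (w : List T) {i j : ℕ} (hij : i < j) (hj : j < w.length) :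
    ∃ u p v q z, w = u ++ p :: (v ++ q :: z) ∧ u.length = i ∧ u.length + 1 + v.length = j := by
  obtain ⟨u, p, z, rfl, rfl⟩ := exists_split w (hij.trans hj)
  obtain ⟨v, q, z', rfl, hv⟩ := exists_split z (i := j - u.length - 1)
    (by simp only [List.length_append, List.length_cons] at hj; omega)
  exact ⟨u, p, v, q, z', rfl, rfl, by omega⟩

/-- The data word over `A × 2ᵏ` that records the letters, the monadic predicates and the data. -/
def expandData (w : List (A × D)) (X : Fin k → Set (Fin w.length)) : List ((A × Set (Fin k)) × D) :=
  List.ofFn fun i => (((w.get i).1, {m | i ∈ X m}), (w.get i).2)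

variable {w : List (A × D)} {X : Fin k → Set (Fin w.length)}

@[simp] theorem length_expandData : (expandData w X).length = w.length := by
  simp [expandData]

theorem map_fst_expandData : (expandData w X).map Prod.fst = expand w X := by
  simp [expandData, expand, List.map_ofFn, Function.comp_def]

theorem relabel_fst_expandData : relabel Prod.fst (expandData w X) = w := by
  simp [expandData, relabel, List.map_ofFn, Function.comp_def]

theorem exists_expandData_eq (W : List ((A × Set (Fin k)) × D)) (h : relabel Prod.fst W = w) :
    ∃ X : Fin k → Set (Fin w.length), expandData w X = W := by
  subst h
  refine ⟨fun m => {i | m ∈ (W[(i : ℕ)]'(by simpa using i.2)).1.2}, ?_⟩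
  apply List.ext_getElem
  · simp
  · intro i h1 h2
    simp only [expandData, relabel, List.getElem_ofFn, List.get_eq_getElem, List.getElem_map]
    rfl

theorem expandData_split {u z : List ((A × Set (Fin k)) × D)} {p : (A × Set (Fin k)) × D}
    (h : expandData w X = u ++ p :: z) {i : Fin w.length} (hi : (i : ℕ) = u.length) :
    p = (((w.get i).1, {m | i ∈ X m}), (w.get i).2) := by
  have h1 : (expandData w X)[(i : ℕ)]? = some p := by
    rw [h, hi]; simp
  have h2 : (expandData w X)[(i : ℕ)]? = some (((w.get i).1, {m | i ∈ X m}), (w.get i).2) := by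
    simp [expandData]
  exact Option.some_injective _ (h1.symm.trans h2)

section Split

variable {u v z : List ((A × Set (Fin k)) × D)} {a b : A × Set (Fin k)} {d e : D}
  {i j : Fin w.length}

theorem lt_of_split (hi : (i : ℕ) = u.length) (hj : (j : ℕ) = u.length + 1 + v.length) : i < j := by
  rw [Fin.lt_def]; omega

theorem sim_iff_of_split (h : expandData w X = u ++ (a, d) :: (v ++ (b, e) :: z))
    (hi : (i : ℕ) = u.length) (hj : (j : ℕ) = u.length + 1 + v.length) :
    Sim w i j ↔ d = e := by
  have h1 := expandData_split h hi
  have h2 := expandData_split (X := X) (u := u ++ (a, d) :: v) (p := (b, e)) (z := z) (by simp [h])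
    (i := j) (by simp; omega)
  simp only [Prod.mk.injEq] at h1 h2
  rw [Sim, h1.2, h2.2]

theorem factor_iff_of_split (h : expandData w X = u ++ (a, d) :: (v ++ (b, e) :: z))
    (hi : (i : ℕ) = u.length) (hj : (j : ℕ) = u.length + 1 + v.length)
    {L : Language (A × Set (Fin k))} : Factor w X L i j ↔ v.map Prod.fst ∈ L := by
  have : ((expand w X).take j).drop (i + 1) = v.map Prod.fst := by
    rw [← map_fst_expandData, h, hi, hj]
    have e1 : u ++ (a, d) :: (v ++ (b, e) :: z) = (u ++ [(a, d)] ++ v) ++ (b, e) :: z := by simp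
    have e2 : u ++ [(a, d)] ++ v = (u ++ [(a, d)]) ++ v := rfl
    rw [e1, List.map_append, List.take_left' (by simp; omega), e2, List.map_append,
      List.drop_left' (by simp)]
  rw [Factor, this]
  exact and_iff_right (lt_of_split hi hj)

theorem classSucc_iff_of_split (h : expandData w X = u ++ (a, d) :: (v ++ (b, e) :: z))
    (hi : (i : ℕ) = u.length) (hj : (j : ℕ) = u.length + 1 + v.length) :
    ClassSucc w i j ↔ d = e ∧ d ∉ v.map Prod.snd := by
  rw [ClassSucc, sim_iff_of_split h hi hj]
  constructor
  · rintro ⟨-, h1, h2⟩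
    refine ⟨h1, fun hd => ?_⟩
    obtain ⟨v₁, c, v₂, rfl, -⟩ := exists_eq_append_first hd
    have hlt : u.length + 1 + v₁.length < w.length := by
      rw [← length_expandData (X := X), h]; simp; omega
    refine h2 ⟨u.length + 1 + v₁.length, hlt⟩ ?_ ?_ ((sim_iff_of_split (X := X) (u := u) (a := a) (d := d) (v := v₁)
      (b := c) (e := d) (z := v₂ ++ (b, e) :: z) (by simp [h]) hi rfl).2 rfl)
    · rw [Fin.lt_def]; dsimp only; omega
    · rw [Fin.lt_def]; simp only [List.length_append, List.length_cons] at hj ⊢; omega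
  · rintro ⟨h1, h2⟩
    refine ⟨lt_of_split hi hj, h1, fun m him hmj hs => h2 ?_⟩
    rw [Fin.lt_def] at him hmj
    obtain ⟨v₁, ⟨c, f⟩, v₂, rfl, hv⟩ := exists_split v (i := m - i - 1) (by omega)
    have := (sim_iff_of_split (X := X) (u := u) (a := a) (d := d) (v := v₁) (b := c) (e := f) (z := v₂ ++ (b, e) :: z)
      (by simp [h]) hi (j := m) (by omega)).1 hs
    simp [this]

end Split

theorem exists_fin_split {W : List ((A × Set (Fin k)) × D)} (hW : expandData w X = W)
    {u z : List ((A × Set (Fin k)) × D)} {p : (A × Set (Fin k)) × D} (h : W = u ++ p :: z) :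
    ∃ i : Fin w.length, (i : ℕ) = u.length :=
  ⟨⟨u.length, by rw [← length_expandData (X := X), hW, h]; simp⟩, rfl⟩

end DataWord

/-! ### Definable binary relations on positions -/

namespace FO2

variable {A D : Type*} {k : ℕ}

open DataWord

/-- The assignment of two positions to the two variables. -/
def assign {n : ℕ} (i j : Fin n) : Fin 2 → Option (Fin n) := ![some i, some j]

/-- Families of binary relations on the positions of data words with `k` monadic predicates. -/
abbrev PosRel (A D : Type*) (k : ℕ) :=
  ∀ (w : List (A × D)) (_ : Fin k → Set (Fin w.length)), Fin w.length → Fin w.length → Prop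

/-- Binary relations defined by formulas. -/
def Definable (P : PosRel A D k) : Prop :=
  ∃ φ : FO2 A k, ∀ w X i j, φ.Sat w X (assign i j) ↔ P w X i j

theorem update_assign_zero {n : ℕ} (i j i' : Fin n) :
    Function.update (assign i j) 0 (some i') = assign i' j := by
  funext x; fin_cases x <;> rfl

theorem update_assign_one {n : ℕ} (i j j' : Fin n) :
    Function.update (assign i j) 1 (some j') = assign i j' := by
  funext x; fin_cases x <;> rfl

namespace Definable

variable {P P' : PosRel A D k}

theorem not (h : Definable P) : Definable fun w X i j => ¬ P w X i j := by
  obtain ⟨φ, hφ⟩ := h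
  exact ⟨φ.neg, fun w X i j => not_congr (hφ w X i j)⟩

theorem and (h : Definable P) (h' : Definable P') :
    Definable fun w X i j => P w X i j ∧ P' w X i j := by
  obtain ⟨φ, hφ⟩ := h
  obtain ⟨ψ, hψ⟩ := h'
  exact ⟨φ.and ψ, fun w X i j => and_congr (hφ w X i j) (hψ w X i j)⟩

theorem congr (h : Definable P) (h' : ∀ w X i j, P' w X i j ↔ P w X i j) : Definable P' := by
  obtain ⟨φ, hφ⟩ := h
  exact ⟨φ, fun w X i j => (hφ w X i j).trans (h' w X i j).symm⟩

theorem or (h : Definable P) (h' : Definable P') :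
    Definable fun w X i j => P w X i j ∨ P' w X i j :=
  (h.not.and h'.not).not.congr fun w X i j => by tauto

theorem imp (h : Definable P) (h' : Definable P') :
    Definable fun w X i j => P w X i j → P' w X i j :=
  (h.and h'.not).not.congr fun w X i j => by tauto

theorem iff (h : Definable P) (h' : Definable P') :
    Definable fun w X i j => (P w X i j ↔ P' w X i j) :=
  ((h.imp h').and (h'.imp h)).congr fun w X i j => by tauto

theorem exists_fst (h : Definable P) : Definable fun w X _ j => ∃ i, P w X i j := by
  obtain ⟨φ, hφ⟩ := h
  refine ⟨φ.ex 0, fun w X i j => exists_congr fun i' => ?_⟩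
  rw [update_assign_zero]
  exact hφ w X i' j

theorem exists_snd (h : Definable P) : Definable fun w X i _ => ∃ j, P w X i j := by
  obtain ⟨φ, hφ⟩ := h
  refine ⟨φ.ex 1, fun w X i j => exists_congr fun j' => ?_⟩
  rw [update_assign_one]
  exact hφ w X i j'

theorem const (p : Prop) : Definable (fun _ _ _ _ => p : PosRel A D k) := by
  have h : Definable (fun _ _ _ _ => True : PosRel A D k) :=
    ⟨.eq 0 0, fun w X i j => by simp [Sat, assign]⟩
  -- The formula may depend on the truth value of `p`, as `p` does not involve the word.
  by_cases hp : p
  · exact h.congr fun _ _ _ _ => by simp [hp]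
  · exact h.not.congr fun _ _ _ _ => by simp [hp]

theorem finite_forall {ι : Type*} [Finite ι] {P : ι → PosRel A D k} (h : ∀ t, Definable (P t)) :
    Definable fun w X i j => ∀ t, P t w X i j := by
  have := Fintype.ofFinite ι
  have key : ∀ s : Finset ι, Definable fun w X i j => ∀ t ∈ s, P t w X i j := by
    classical
    intro s
    induction s using Finset.induction_on with
    | empty => exact (const True).congr fun _ _ _ _ => by simp
    | insert a s _ ih => exact ((h a).and ih).congr fun _ _ _ _ => by simp
  exact (key Finset.univ).congr fun _ _ _ _ => by simp

theorem finite_exists {ι : Type*} [Finite ι] {P : ι → PosRel A D k} (h : ∀ t, Definable (P t)) :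
    Definable fun w X i j => ∃ t, P t w X i j :=
  (finite_forall fun t => (h t).not).not.congr fun w X i j => by simp

theorem gt : Definable (fun _ _ i j => j < i : PosRel A D k) :=
  ⟨.lt 1 0, fun w X i j => by simp [Sat, assign]⟩

theorem eq : Definable (fun _ _ i j => i = j : PosRel A D k) :=
  ⟨.eq 0 1, fun w X i j => by simp [Sat, assign, eq_comm]⟩

theorem classSucc : Definable (fun w _ i j => ClassSucc w i j : PosRel A D k) :=
  ⟨.csucc 0 1, fun w X i j => by simp [Sat, assign]⟩

theorem letter_fst [Finite A] (S : Set (A × Set (Fin k))) :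
    Definable (fun w X i _ => ((w.get i).1, {m | i ∈ X m}) ∈ S : PosRel A D k) := by
  have h1 : ∀ a, Definable (fun w _ i _ => (w.get i).1 = a : PosRel A D k) := fun a =>
    ⟨.letter a 0, fun w X i j => by simp [Sat, assign]⟩
  have h2 : ∀ m, Definable (fun _ X i _ => i ∈ X m : PosRel A D k) := fun m =>
    ⟨.mon m 0, fun w X i j => by simp [Sat, assign]⟩
  refine (finite_exists fun b : A × Set (Fin k) => ((const (b ∈ S)).and (h1 b.1)).and
    (finite_forall fun m => (h2 m).iff (const (m ∈ b.2)))).congr fun w X i j => ?_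
  constructor
  · intro h
    exact ⟨_, ⟨h, rfl⟩, fun m => Iff.rfl⟩
  · rintro ⟨⟨a, s⟩, ⟨h, h3⟩, h4⟩
    have : {m | i ∈ X m} = s := Set.ext h4
    rw [h3, this]
    exact h

/-- A property of the first variable is moved to the second one by requantifying the first with an
equality. -/
theorem letter_snd [Finite A] (S : Set (A × Set (Fin k))) :
    Definable (fun w X _ j => ((w.get j).1, {m | j ∈ X m}) ∈ S : PosRel A D k) :=
  ((eq.and (letter_fst S)).exists_fst).congr fun w X i j => by simp

/-- Regular predicates see only the letters strictly between two positions. The end letters range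
over a finite alphabet, and fixing them turns `K` into a regular quotient. -/
theorem closedFactor [Finite A] {K : Language (A × Set (Fin k))} (hK : K.IsRegular) :
    Definable (fun w X i j => Factor w X (.ofPred fun v =>
      ((w.get i).1, {m | i ∈ X m}) :: (v ++ [((w.get j).1, {m | j ∈ X m})]) ∈ K) i j :
        PosRel A D k) := by
  have hreg : ∀ a b : A × Set (Fin k),
      Language.IsRegular (.ofPred fun v => a :: (v ++ [b]) ∈ K) := by
    intro a b
    obtain ⟨S, _, st, s₀, F, hF⟩ := hK.exists_foldl
    refine (Language.isRegular_foldl st (st s₀ a) (fun s => st s b ∈ F)).of_mem_iff fun v => ?_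
    simp [hF]
  have h1 : ∀ a b : A × Set (Fin k), Definable (fun w X i j =>
      Factor w X (.ofPred fun v => a :: (v ++ [b]) ∈ K) i j : PosRel A D k) := fun a b =>
    ⟨.reg _ (hreg a b) 0 1, fun w X i j => by simp [Sat, assign]⟩
  refine (finite_exists fun a => finite_exists fun b =>
    ((letter_fst {a}).and (letter_snd {b})).and (h1 a b)).congr fun w X i j => ?_
  constructor
  · intro h
    exact ⟨_, _, ⟨rfl, rfl⟩, h⟩
  · rintro ⟨a, b, ⟨h2, h3⟩, h⟩
    rw [Set.mem_singleton_iff] at h2 h3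
    subst h2 h3
    exact h

end Definable

end FO2

/-! ### Class-regular data languages are definable -/

namespace ClassCond

variable {A D : Type*} {k : ℕ}

open DataWord FO2

/-- The class-regular conditions in terms of positions. -/
def PosHolds (C : ClassCond (A × Set (Fin k))) : PosRel A D k := fun w X i j =>
  (ClassSucc w i j → Factor w X (.ofPred fun v =>
    ((w.get i).1, {m | i ∈ X m}) :: (v ++ [((w.get j).1, {m | j ∈ X m})]) ∈ C.link) i j) ∧
  ((¬ ∃ i', ClassSucc w i' j) → ((w.get j).1, {m | j ∈ X m}) ∈ C.fst) ∧
  ((¬ ∃ j', ClassSucc w i j') → ((w.get i).1, {m | i ∈ X m}) ∈ C.lst) ∧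
  -- Here `i` is the first and `j` the last position, so the closed factor is the whole word;
  -- one-letter words are separate because `Factor` needs `i < j`.
  ((¬ ∃ j', j' < i) → (¬ ∃ i', j < i') →
    (i = j ∧ ((w.get i).1, {m | i ∈ X m}) ∈ {b | [b] ∈ C.whole}) ∨ Factor w X (.ofPred fun v =>
    ((w.get i).1, {m | i ∈ X m}) :: (v ++ [((w.get j).1, {m | j ∈ X m})]) ∈ C.whole) i j)

theorem definable_posHolds [Finite A] (C : ClassCond (A × Set (Fin k))) :
    Definable (C.PosHolds : PosRel A D k) :=
  (Definable.classSucc.imp (Definable.closedFactor C.link_regular)).and <|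
    (Definable.classSucc.exists_fst.not.imp (Definable.letter_snd _)).and <|
    (Definable.classSucc.exists_snd.not.imp (Definable.letter_fst _)).and <|
    Definable.gt.exists_snd.not.imp <| Definable.gt.exists_fst.not.imp <|
    (Definable.eq.and (Definable.letter_fst _)).or (Definable.closedFactor C.whole_regular)

theorem holds_expandData_iff {C : ClassCond (A × Set (Fin k))} {w : List (A × D)} (hw : w ≠ [])
    {X : Fin k → Set (Fin w.length)} :
    C.Holds (expandData w X) ↔ ∀ i j, C.PosHolds w X i j := by
  have hsplit : ∀ i : Fin w.length, ∃ u a d z, expandData w X = u ++ (a, d) :: z ∧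
      (i : ℕ) = u.length := by
    intro i
    obtain ⟨u, ⟨a, d⟩, z, h, h'⟩ := exists_split (expandData w X) (i := i) (by simp)
    exact ⟨u, a, d, z, h, h'.symm⟩
  have hsplit₂ : ∀ i j : Fin w.length, i < j → ∃ u a d v b e z,
      expandData w X = u ++ (a, d) :: (v ++ (b, e) :: z) ∧
      (i : ℕ) = u.length ∧ (j : ℕ) = u.length + 1 + v.length := by
    intro i j hij
    obtain ⟨u, ⟨a, d⟩, v, ⟨b, e⟩, z, h, h', h''⟩ := exists_split₂ (expandData w X)
      (i := i) (j := j) hij (by simp)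
    exact ⟨u, a, d, v, b, e, z, h, h'.symm, h''.symm⟩
  have hletter : ∀ (i : Fin w.length) u a d z, expandData w X = u ++ (a, d) :: z →
      (i : ℕ) = u.length → ((w.get i).1, {m | i ∈ X m}) = a := by
    intro i u a d z h hi
    exact (congrArg Prod.fst (expandData_split h hi)).symm
  have hletter₂ : ∀ (j : Fin w.length) u a d v b e z,
      expandData w X = u ++ (a, d) :: (v ++ (b, e) :: z) →
      (j : ℕ) = u.length + 1 + v.length → ((w.get j).1, {m | j ∈ X m}) = b := by
    intro j u a d v b e z h hj
    exact hletter j (u ++ (a, d) :: v) b e z (by simp [h]) (by simp; omega)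
  have hexists : ∀ {u p z}, expandData w X = u ++ p :: z → ∃ i : Fin w.length, (i : ℕ) = u.length :=
    fun h => exists_fin_split rfl h
  constructor
  · intro h i j
    refine ⟨?_, ?_, ?_, ?_⟩
    · intro hc
      obtain ⟨u, a, d, v, b, e, z, hW, hi, hj⟩ := hsplit₂ i j hc.1
      obtain ⟨rfl, hd⟩ := (classSucc_iff_of_split hW hi hj).1 hc
      rw [factor_iff_of_split hW hi hj, hletter i u a d _ hW hi, hletter₂ j u a d v b _ z hW hj]
      exact h.link u a d v b z hW hd
    · intro hn
      obtain ⟨u, a, d, z, hW, hj⟩ := hsplit j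
      rw [hletter j u a d z hW hj]
      refine h.fst u a d z hW fun hd => hn ?_
      obtain ⟨u₁, b, v, rfl, hv⟩ := exists_eq_append_last hd
      have hW' : expandData w X = u₁ ++ (b, d) :: (v ++ (a, d) :: z) := by simp [hW]
      obtain ⟨i', hi'⟩ := hexists hW'
      exact ⟨i', (classSucc_iff_of_split hW' hi' (by simp at hj; omega)).2 ⟨rfl, hv⟩⟩
    · intro hn
      obtain ⟨u, a, d, z, hW, hi⟩ := hsplit i
      rw [hletter i u a d z hW hi]
      refine h.lst u a d z hW fun hd => hn ?_
      obtain ⟨v, b, z, rfl, hv⟩ := exists_eq_append_first hd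
      obtain ⟨j', hj'⟩ := hexists (u := u ++ (a, d) :: v) (p := (b, d)) (z := z) (by simp [hW])
      exact ⟨j', (classSucc_iff_of_split hW hi (by simp at hj'; omega)).2 ⟨rfl, hv⟩⟩
    · intro h1 h2
      rcases lt_trichotomy i j with hij | rfl | hij
      · right
        obtain ⟨u, a, d, v, b, e, z, hW, hi, hj⟩ := hsplit₂ i j hij
        rw [factor_iff_of_split hW hi hj, hletter i u a d _ hW hi, hletter₂ j u a d v b _ z hW hj]
        obtain rfl : u = [] := by
          rcases u with _ | ⟨p, u⟩
          · rfl
          · exact absurd ⟨⟨0, by omega⟩, by rw [Fin.lt_def]; simp at hi; simp; omega⟩ h1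
        obtain rfl : z = [] := by
          rcases z with _ | ⟨p, z⟩
          · rfl
          · have := length_expandData (X := X)
            rw [hW] at this
            simp at this
            exact absurd ⟨⟨j + 1, by simp at hj; omega⟩, by rw [Fin.lt_def]; simp⟩ h2
        have := h.whole
        rw [hW] at this
        simpa using this
      · left
        refine ⟨rfl, ?_⟩
        obtain ⟨u, a, d, z, hW, hi⟩ := hsplit i
        rw [hletter i u a d z hW hi]
        obtain rfl : u = [] := by
          rcases u with _ | ⟨p, u⟩
          · rfl
          · exact absurd ⟨⟨0, by omega⟩, by rw [Fin.lt_def]; simp at hi; simp; omega⟩ h1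
        obtain rfl : z = [] := by
          rcases z with _ | ⟨p, z⟩
          · rfl
          · have := length_expandData (X := X)
            rw [hW] at this
            simp at this
            exact absurd ⟨⟨i + 1, by simp at hi; omega⟩, by rw [Fin.lt_def]; simp⟩ h2
        have := h.whole
        rw [hW] at this
        simpa using this
      · exact absurd ⟨j, hij⟩ h1
  · intro h
    have hlen : 0 < w.length := List.length_pos_iff.2 hw
    refine ⟨?_, ?_, ?_, ?_⟩
    · have h1 := (h ⟨0, hlen⟩ ⟨w.length - 1, by omega⟩).2.2.2
        (by rintro ⟨j', hj'⟩; simp [Fin.lt_def] at hj')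
        (by rintro ⟨j', hj'⟩; simp [Fin.lt_def] at hj'; omega)
      rcases h1 with ⟨h1, h2⟩ | h1
      · obtain ⟨u, a, d, z, hW, hi⟩ := hsplit ⟨0, hlen⟩
        rw [hletter _ u a d z hW hi] at h2
        simp only [Fin.mk.injEq] at h1
        have h3 := length_expandData (X := X)
        rw [hW] at h3
        simp only [List.length_append, List.length_cons] at h3
        have hu : u = [] := List.length_eq_zero_iff.1 hi.symm
        have hz : z = [] := List.length_eq_zero_iff.1 (by omega)
        subst hu hz
        rw [hW]
        exact h2
      · obtain ⟨u, a, d, v, b, e, z, hW, hi, hj⟩ := hsplit₂ _ _ h1.1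
        rw [factor_iff_of_split hW hi hj, hletter _ u a d _ hW hi,
          hletter₂ _ u a d v b _ z hW hj] at h1
        have h3 := length_expandData (X := X)
        rw [hW] at h3
        simp only [List.length_append, List.length_cons] at h3 hj
        have hu : u = [] := List.length_eq_zero_iff.1 hi.symm
        have hz : z = [] := List.length_eq_zero_iff.1 (by omega)
        subst hu hz
        rw [hW]
        simpa using h1
    · intro u a d v b z hW hd
      obtain ⟨i, hi⟩ := hexists hW
      obtain ⟨j, hj⟩ := hexists (u := u ++ (a, d) :: v) (p := (b, d)) (z := z) (by simp [hW])
      have hj' : (j : ℕ) = u.length + 1 + v.length := by simp at hj; omega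
      have h1 := (h i j).1 ((classSucc_iff_of_split hW hi hj').2 ⟨rfl, hd⟩)
      rwa [factor_iff_of_split hW hi hj', hletter i u a d _ hW hi,
        hletter₂ j u a d v b _ z hW hj'] at h1
    · intro u a d z hW hd
      obtain ⟨j, hj⟩ := hexists hW
      rw [← hletter j u a d z hW hj]
      refine (h j j).2.1 ?_
      rintro ⟨i, hc⟩
      obtain ⟨u', a', d', v, b, e, z', hW', hi, hj'⟩ := hsplit₂ i j hc.1
      obtain ⟨rfl, -⟩ := (classSucc_iff_of_split hW' hi hj').1 hc
      have h1 : u ++ (a, d) :: z = (u' ++ (a', d') :: v) ++ (b, d') :: z' := by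
        rw [← hW, hW']; simp
      obtain ⟨rfl, h2⟩ := List.append_inj h1 (by simp; omega)
      simp only [List.cons.injEq, Prod.mk.injEq] at h2
      exact hd (by simp [h2.1.2])
    · intro u a d z hW hd
      obtain ⟨i, hi⟩ := hexists hW
      rw [← hletter i u a d z hW hi]
      refine (h i i).2.2.1 ?_
      rintro ⟨j, hc⟩
      obtain ⟨u', a', d', v, b, e, z', hW', hi', hj'⟩ := hsplit₂ i j hc.1
      obtain ⟨rfl, -⟩ := (classSucc_iff_of_split hW' hi' hj').1 hc
      obtain ⟨rfl, h2⟩ := List.append_inj (hW.symm.trans hW') (by omega)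
      simp only [List.cons.injEq, Prod.mk.injEq] at h2
      obtain ⟨⟨rfl, rfl⟩, rfl⟩ := h2
      exact hd (by simp)

/-- The universal sentence holds vacuously in the empty word. If the conditions reject that word, a
conjunct demanding some position excludes it. -/
theorem exists_emso2 [Finite A] (C : ClassCond (A × Set (Fin k))) :
    ∃ ψ : EMSO2 A, ∀ w : List (A × D), w ∈ ψ.language D ↔
      ∃ X : Fin k → Set (Fin w.length), C.Holds (expandData w X) := by
  obtain ⟨χ, hχ⟩ := C.definable_posHolds (D := D)
  have hup : ∀ {n : ℕ} (i j : Fin n), Function.update (Function.update (fun _ => none) 0 (some i)) 1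
      (some j) = assign i j := by
    intro n i j; funext x; fin_cases x <;> rfl
  have hall : ∀ (w : List (A × D)) (X : Fin k → Set (Fin w.length)),
      (((χ.neg.ex 1).ex 0).neg).Sat w X (fun _ => none) ↔ ∀ i j, C.PosHolds w X i j := by
    intro w X
    simp only [Sat, hup, hχ]
    push Not
    rfl
  by_cases h0 : [] ∈ C.whole
  · refine ⟨⟨k, ((χ.neg.ex 1).ex 0).neg, ?_⟩, fun w => exists_congr fun X => ?_⟩
    · ext x; fin_cases x <;> simp [freeVars]
    · rw [hall]
      rcases eq_or_ne w [] with rfl | hw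
      · refine ⟨fun _ => ?_, fun _ i => i.elim0⟩
        have : expandData ([] : List (A × D)) X = [] := rfl
        rw [this]
        exact ⟨h0, by simp, by simp, by simp⟩
      · exact (holds_expandData_iff hw).symm
  · refine ⟨⟨k, (((χ.neg.ex 1).ex 0).neg).and (.ex 0 (.eq 0 0)), ?_⟩,
      fun w => exists_congr fun X => ?_⟩
    · ext x; fin_cases x <;> simp [freeVars]
    · change (((χ.neg.ex 1).ex 0).neg).Sat w X (fun _ => none) ∧ _ ↔ _
      rw [hall]
      rcases eq_or_ne w [] with rfl | hw
      · refine ⟨fun ⟨_, i, _⟩ => i.elim0, fun h => absurd h.whole h0⟩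
      · rw [holds_expandData_iff hw]
        refine and_iff_left ⟨⟨0, List.length_pos_iff.2 hw⟩, ?_⟩
        simp [Sat]

end ClassCond

theorem IsClassRegular.definable {A D : Type*} [Finite A] {L : Set (List (A × D))}
    (h : IsClassRegular L) : DefinableInEMSO2 L := by
  obtain ⟨n, π, C, hL⟩ := h
  suffices ∃ (k : ℕ) (C' : ClassCond (A × Set (Fin k))), ∀ w, w ∈ L ↔
      ∃ X : Fin k → Set (Fin w.length), C'.Holds (DataWord.expandData w X) by
    obtain ⟨k, C', h⟩ := this
    obtain ⟨ψ, hψ⟩ := C'.exists_emso2 (D := D)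
    exact ⟨ψ, Set.ext fun w => (hψ w).trans (h w).symm⟩
  -- Over no letters only the empty word exists; the decoding of subsets below needs a nonempty
  -- alphabet.
  rcases n with _ | n
  · refine ⟨0, .ofWhole (.ofPred (fun x => (∀ b ∈ x, False) ) ⊓ .ofPred fun _ => [] ∈ C.whole)
      ((Language.isRegular_forall_mem _).inf (Language.isRegular_setOf_const _)), fun w => ?_⟩
    rw [hL]
    constructor
    · rintro ⟨w', hw', rfl⟩
      rcases w' with _ | ⟨⟨a, _⟩, _⟩
      · refine ⟨fun _ => ∅, ClassCond.holds_ofWhole.2 ⟨?_, hw'.whole⟩⟩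
        change ∀ b ∈ [], False
        simp
      · exact a.elim0
    · rintro ⟨X, hX⟩
      obtain ⟨h1, h2⟩ := ClassCond.holds_ofWhole.1 hX
      have h3 : DataWord.expandData w X = [] := by
        rcases h4 : DataWord.expandData w X with _ | ⟨p, W⟩
        · rfl
        · rw [h4] at h1
          exact (h1 p.1 (by simp)).elim
      have h4 : w = [] := by
        rw [← DataWord.relabel_fst_expandData (w := w) (X := X), h3]; rfl
      exact ⟨[], ⟨h2, by simp, by simp, by simp⟩, h4.symm⟩
  · have hinj : Function.Injective fun t : Fin (n + 1) => ({t} : Set (Fin (n + 1))) :=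
      Set.singleton_injective
    -- The auxiliary letter `t` is coded by making exactly the predicate `t` true. Other subsets
    -- decode to some letter, which is harmless: any decoded word that satisfies the conditions is a
    -- legitimate preimage.
    let f : Set (Fin (n + 1)) → Fin (n + 1) := Function.invFun fun t => {t}
    have hf : ∀ t, f {t} = t := Function.leftInverse_invFun hinj
    refine ⟨n + 1, (C.comap fun b => f b.2).inter (.ofWhole _
      (Language.isRegular_forall_mem fun b => π (f b.2) = b.1)), fun w => ?_⟩
    rw [hL]
    simp only [ClassCond.holds_inter, ClassCond.holds_ofWhole, ClassCond.holds_comap]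
    constructor
    · rintro ⟨w', hw', rfl⟩
      obtain ⟨X, hX⟩ := DataWord.exists_expandData_eq (w := relabel π w')
        (relabel (fun t => (π t, ({t} : Set (Fin (n + 1))))) w') (relabel_relabel _ _ _)
      refine ⟨X, ?_, ?_⟩
      · rw [hX, relabel_relabel]
        have : (fun b : A × Set (Fin (n + 1)) => f b.2) ∘ (fun t => (π t, {t})) = id :=
          funext hf
        rwa [this, relabel_id]
      · rw [hX, relabel_map_fst]
        intro b hb
        obtain ⟨t, -, rfl⟩ := List.mem_map.1 hb
        rw [hf]
    · rintro ⟨X, h1, h2⟩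
      refine ⟨_, h1, ?_⟩
      rw [relabel_relabel]
      conv_rhs => rw [← DataWord.relabel_fst_expandData (w := w) (X := X)]
      refine List.map_congr_left fun p hp => ?_
      exact Prod.ext (h2 p.1 (List.mem_map_of_mem hp)) rfl

/-! ### Annotations of data words -/

section Annotation

universe u

variable {T B : Type u} {T₁ T₂ D : Type*}

/-- Every data word can be relabelled by `π` from one that satisfies the conditions `C`. -/
def IsAnnotation (π : T₁ → T₂) (C : ClassCond T₁) (D : Type*) : Prop :=
  ∀ w : List (T₂ × D), ∃ w', C.Holds w' ∧ relabel π w' = w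

theorem IsAnnotation.comp {T₃ : Type*} {π : T₁ → T₂} {C : ClassCond T₁} {π' : T₂ → T₃}
    {C' : ClassCond T₂} (h : IsAnnotation π C D) (h' : IsAnnotation π' C' D) :
    IsAnnotation (π' ∘ π) (C.inter (C'.comap π)) D := by
  intro w
  obtain ⟨w', hw', rfl⟩ := h' w
  obtain ⟨w'', hw'', rfl⟩ := h w'
  exact ⟨w'', ClassCond.holds_inter.2 ⟨hw'', ClassCond.holds_comap.2 hw'⟩,
    (relabel_relabel _ _ _).symm⟩

namespace ClassCond

/-- The conditions `C₁` and `C₂` on the two components, which have the same image. -/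
def join {T₃ : Type*} (π₁ : T₁ → T₃) (C₁ : ClassCond T₁) (π₂ : T₂ → T₃) (C₂ : ClassCond T₂) :
    ClassCond (T₁ × T₂) :=
  ((C₁.comap Prod.fst).inter (C₂.comap Prod.snd)).inter
    (.ofWhole _ (Language.isRegular_forall_mem fun b => π₁ b.1 = π₂ b.2))

theorem holds_join {T₃ : Type*} {π₁ : T₁ → T₃} {C₁ : ClassCond T₁} {π₂ : T₂ → T₃}
    {C₂ : ClassCond T₂} {w : List ((T₁ × T₂) × D)} :
    (join π₁ C₁ π₂ C₂).Holds w ↔ C₁.Holds (relabel Prod.fst w) ∧ C₂.Holds (relabel Prod.snd w) ∧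
      ∀ b ∈ w.map Prod.fst, π₁ b.1 = π₂ b.2 := by
  rw [join, holds_inter, holds_inter, holds_comap, holds_comap, holds_ofWhole, and_assoc]
  rfl

/-- Lets independent annotations coexist, as required for Boolean combinations. -/
theorem isAnnotation_join {T₃ : Type*} {π₁ : T₁ → T₃} {C₁ : ClassCond T₁} {π₂ : T₂ → T₃}
    {C₂ : ClassCond T₂} (h₁ : IsAnnotation π₁ C₁ D) (h₂ : IsAnnotation π₂ C₂ D) :
    IsAnnotation (π₁ ∘ Prod.fst) (join π₁ C₁ π₂ C₂) D := by
  intro w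
  obtain ⟨w₁, hw₁, rfl⟩ := h₁ w
  obtain ⟨w₂, hw₂, h⟩ := h₂ (relabel π₁ w₁)
  obtain ⟨w, rfl, rfl⟩ := exists_relabel_prod w₁ w₂ h.symm
  refine ⟨w, holds_join.2 ⟨hw₁, hw₂, ?_⟩, (relabel_relabel _ _ _).symm⟩
  rw [relabel_relabel, relabel_relabel] at h
  intro b hb
  obtain ⟨p, hp, rfl⟩ := List.mem_map.1 hb
  exact (congrArg Prod.fst (List.map_inj_left.1 h p hp)).symm

theorem _root_.relabel_comp_fst_eq {T₃ : Type*} {π₁ : T₁ → T₃} {π₂ : T₂ → T₃}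
    {w : List ((T₁ × T₂) × D)} (h : ∀ b ∈ w.map Prod.fst, π₁ b.1 = π₂ b.2) :
    relabel (π₁ ∘ Prod.fst) w = relabel (π₂ ∘ Prod.snd) w :=
  List.map_congr_left fun p hp => Prod.ext (h p.1 (List.mem_map_of_mem hp)) rfl

end ClassCond

/-- The unary property `U` of positions, which are given by the prefix before them, their letter
and data value, and the suffix after them, can be read off from a class-regular annotation. -/
def Recognizable (U : List (T × D) → T → D → List (T × D) → Prop) : Prop :=
  ∃ (T' : Type u) (_ : Finite T') (π : T' → T) (C : ClassCond T') (S : Set T'),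
    IsAnnotation π C D ∧ ∀ u a d z, C.Holds (u ++ (a, d) :: z) →
      (a ∈ S ↔ U (relabel π u) (π a) d (relabel π z))

namespace Recognizable

variable {U U' : List (T × D) → T → D → List (T × D) → Prop}

theorem or (h : Recognizable U) (h' : Recognizable U') :
    Recognizable fun u a d z => U u a d z ∨ U' u a d z := by
  obtain ⟨T₁, _, π₁, C₁, S₁, hA₁, hU₁⟩ := h
  obtain ⟨T₂, _, π₂, C₂, S₂, hA₂, hU₂⟩ := h'
  refine ⟨T₁ × T₂, inferInstance, π₁ ∘ Prod.fst, .join π₁ C₁ π₂ C₂, {b | b.1 ∈ S₁ ∨ b.2 ∈ S₂},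
    ClassCond.isAnnotation_join hA₁ hA₂, fun u a d z h => ?_⟩
  obtain ⟨h1, h2, h3⟩ := ClassCond.holds_join.1 h
  have eu : relabel (π₁ ∘ Prod.fst) u = relabel (π₂ ∘ Prod.snd) u :=
    relabel_comp_fst_eq fun b hb => h3 b (by simp at hb ⊢; tauto)
  have ez : relabel (π₁ ∘ Prod.fst) z = relabel (π₂ ∘ Prod.snd) z :=
    relabel_comp_fst_eq fun b hb => h3 b (by simp at hb ⊢; tauto)
  have ea : π₁ a.1 = π₂ a.2 := h3 a (by simp)
  rw [relabel_append, relabel_cons] at h1 h2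
  have h4 := hU₁ _ _ _ _ h1
  have h5 := hU₂ _ _ _ _ h2
  rw [relabel_relabel, relabel_relabel] at h4 h5
  rw [← eu, ← ez, ← ea] at h5
  exact or_congr h4 h5

theorem of_letter [Finite T] (S : Set T) :
    Recognizable (fun _ a _ _ => a ∈ S : List (T × D) → T → D → List (T × D) → Prop) :=
  ⟨T, inferInstance, id, .ofWhole _ (Language.isRegular_setOf_const True), S,
    fun w => ⟨w, ClassCond.holds_ofWhole.2 trivial, relabel_id w⟩, fun _ _ _ _ _ => Iff.rfl⟩

theorem reverse (h : Recognizable U) : Recognizable fun u a d z => U z.reverse a d u.reverse := by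
  obtain ⟨T', _, π, C, S, hA, hU⟩ := h
  refine ⟨T', inferInstance, π, C.reverse, S, fun w => ?_, fun u a d z h => ?_⟩
  · obtain ⟨w', h1, h2⟩ := hA w.reverse
    exact ⟨w'.reverse, h1.reverse, by rw [relabel_reverse, h2, List.reverse_reverse]⟩
  · rw [ClassCond.holds_reverse] at h
    rw [hU z.reverse a d u.reverse (by simpa using h)]
    simp

theorem congr (h : Recognizable U) (h' : ∀ u a d z, U' u a d z ↔ U u a d z) : Recognizable U' := by
  obtain ⟨T', _, π, C, S, hA, hU⟩ := h
  exact ⟨T', inferInstance, π, C, S, hA, fun u a d z hw => (hU u a d z hw).trans (h' _ _ _ _).symm⟩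

end Recognizable

end Annotation

/-! ### Existential quantification over later positions -/

/-- The possible relations between the data values of two positions: consecutive in the same class,
in the same class but not consecutive, in different classes. -/
inductive Kind
  | next
  | later
  | diff

namespace Kind

instance : Finite Kind :=
  Finite.of_surjective (fun i : Fin 3 => ![Kind.next, .later, .diff] i) fun k => by
    cases k
    · exact ⟨0, rfl⟩
    · exact ⟨1, rfl⟩
    · exact ⟨2, rfl⟩

variable {D : Type*}

/-- The relation between data values `d` and `e` that are separated by the sequence `l`. -/
def Holds (d : D) (l : List D) (e : D) : Kind → Prop
  | next => d = e ∧ d ∉ l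
  | later => d = e ∧ d ∈ l
  | diff => d ≠ e

theorem exists_holds (d : D) (l : List D) (e : D) : ∃ k : Kind, k.Holds d l e := by
  by_cases h : d = e
  · by_cases h' : d ∈ l
    · exact ⟨later, h, h'⟩
    · exact ⟨next, h, h'⟩
  · exact ⟨diff, h⟩

theorem holds_reverse {d : D} {l : List D} {e : D} {k : Kind} :
    k.Holds d l.reverse e ↔ k.Holds e l d := by
  cases k <;> simp only [Holds, List.mem_reverse]
  · constructor <;> (rintro ⟨rfl, h⟩; exact ⟨rfl, h⟩)
  · constructor <;> (rintro ⟨rfl, h⟩; exact ⟨rfl, h⟩)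
  · exact ne_comm

end Kind

/-- Trichotomy for two marked positions of one word. -/
theorem append_cons_eq_append_cons {T : Type*} {v v' z z' : List T} {p p' : T}
    (h : v ++ p :: z = v' ++ p' :: z') :
    (∃ y, v = v' ++ p' :: y ∧ z' = y ++ p :: z) ∨ (v = v' ∧ p = p' ∧ z = z') ∨
      ∃ y, v' = v ++ p :: y ∧ z = y ++ p' :: z' := by
  induction v generalizing v' with
  | nil =>
    rcases v' with _ | ⟨q, v'⟩
    · simp only [List.nil_append, List.cons.injEq] at h
      exact Or.inr (Or.inl ⟨rfl, h⟩)
    · simp only [List.nil_append, List.cons_append, List.cons.injEq] at h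
      exact Or.inr (Or.inr ⟨v', by simp [h.1], h.2⟩)
  | cons q v ih =>
    rcases v' with _ | ⟨q', v'⟩
    · simp only [List.nil_append, List.cons_append, List.cons.injEq] at h
      exact Or.inl ⟨v, by simp [h.1], h.2.symm⟩
    · simp only [List.cons_append, List.cons.injEq] at h
      rcases ih h.2 with ⟨y, h1, h2⟩ | ⟨h1, h2⟩ | ⟨y, h1, h2⟩
      · exact Or.inl ⟨y, by simp [h.1, h1], h2⟩
      · exact Or.inr (Or.inl ⟨by rw [h.1, h1], h2⟩)
      · exact Or.inr (Or.inr ⟨y, by simp [h.1, h1], h2⟩)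

namespace Future

universe u

variable {T : Type u} {D σ : Type*}

section

variable (st : σ → T → σ) (F : Set σ)

/-- The states from which some nonempty prefix of the word leads to an accepting state. -/
def anySet (z : List T) : Set σ :=
  {q | ∃ v b z', z = v ++ b :: z' ∧ (v ++ [b]).foldl st q ∈ F}

/-- The states from which some prefix of the word leads to an accepting state, and the last data
value of that prefix is in the given relation to `d`. -/
def kindSet (d : D) (z : List (T × D)) (k : Kind) : Set σ :=
  {q | ∃ v b e z', z = v ++ (b, e) :: z' ∧ k.Holds d (v.map Prod.snd) e ∧
    (v.map Prod.fst ++ [b]).foldl st q ∈ F}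

/-- A step that records visits of accepting states. -/
def hitStep (p : σ × Prop) (b : T) : σ × Prop := (st p.1 b, p.2 ∨ st p.1 b ∈ F)

/-- The value of `kindSet` as a function of the factor up to the class successor. -/
def linkVal (g : σ → σ × Prop) (b : T) (E : Kind → Set σ) : Kind → Set σ
  | .next => {q | st (g q).1 b ∈ F}
  | .later => {q | st (g q).1 b ∈ E .next ∨ st (g q).1 b ∈ E .later}
  | .diff => {q | (g q).2 ∨ st (g q).1 b ∈ E .diff}

variable {st F}

theorem anySet_cons (b : T) (z : List T) :
    anySet st F (b :: z) = {q | st q b ∈ F ∨ st q b ∈ anySet st F z} := by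
  ext q
  constructor
  · rintro ⟨_ | ⟨c, v⟩, b', z', h, h'⟩
    · simp only [List.nil_append, List.cons.injEq] at h
      obtain ⟨rfl, rfl⟩ := h
      exact Or.inl h'
    · simp only [List.cons_append, List.cons.injEq] at h
      obtain ⟨rfl, rfl⟩ := h
      exact Or.inr ⟨v, b', z', rfl, h'⟩
  · rintro (h | ⟨v, b', z', rfl, h⟩)
    · exact ⟨[], b, z, rfl, h⟩
    · exact ⟨b :: v, b', z', rfl, h⟩

theorem anySet_eq_foldr (z : List T) :
    anySet st F z = z.foldr (fun b N => {q | st q b ∈ F ∨ st q b ∈ N}) ∅ := by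
  induction z with
  | nil =>
    ext q
    simp [anySet]
  | cons b z ih => rw [anySet_cons, ih, List.foldr_cons]

theorem foldl_hitStep (v : List T) (q : σ) :
    v.foldl (hitStep st F) (q, False) = (v.foldl st q, q ∈ anySet st F v) := by
  have key : ∀ (v : List T) (q : σ) (p : Prop),
      v.foldl (hitStep st F) (q, p) = (v.foldl st q, p ∨ q ∈ anySet st F v) := by
    intro v
    induction v with
    | nil => intro q p; simp [anySet]
    | cons b v ih =>
      intro q p
      rw [List.foldl_cons, hitStep, ih, anySet_cons, or_assoc]
      rfl
  rw [key, false_or]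

/-- After the last occurrence of `d` every position has a different data value, so the data may be
ignored. -/
theorem kindSet_of_notMem {d : D} {z : List (T × D)} (h : d ∉ z.map Prod.snd) :
    kindSet st F d z .next = ∅ ∧ kindSet st F d z .later = ∅ ∧
      kindSet st F d z .diff = anySet st F (z.map Prod.fst) := by
  refine ⟨?_, ?_, ?_⟩
  · rw [Set.eq_empty_iff_forall_notMem]
    rintro q ⟨v, b, e, z', rfl, ⟨rfl, -⟩, -⟩
    simp at h
  · rw [Set.eq_empty_iff_forall_notMem]
    rintro q ⟨v, b, e, z', rfl, ⟨rfl, -⟩, -⟩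
    simp at h
  · ext q
    constructor
    · rintro ⟨v, b, e, z', rfl, -, h'⟩
      exact ⟨v.map Prod.fst, b, z'.map Prod.fst, by simp, h'⟩
    · rintro ⟨v, b, z', hz, h'⟩
      obtain ⟨v, y, rfl, rfl, h2⟩ := List.map_eq_append_iff.1 hz
      obtain ⟨⟨b, e⟩, z', rfl, rfl, rfl⟩ := List.map_eq_cons_iff.1 h2
      refine ⟨v, b, e, z', rfl, ?_, h'⟩
      rintro rfl
      simp at h

/-- Everything is expressed from the next occurrence of `d`. That position is the only `next` one;
its own `next` and `later` positions become `later`; a `diff` position lies either inside `v`, where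
all values differ from `d`, or beyond. -/
theorem kindSet_append {d : D} {v z : List (T × D)} {b : T} (h : d ∉ v.map Prod.snd) :
    kindSet st F d (v ++ (b, d) :: z) =
      linkVal st F (fun q => (v.map Prod.fst).foldl (hitStep st F) (q, False)) b
        (kindSet st F d z) := by
  funext k
  ext q
  have hfold : ∀ y : List (T × D), ∀ c, ((v ++ (b, d) :: y).map Prod.fst ++ [c]).foldl st q =
      (y.map Prod.fst ++ [c]).foldl st (st ((v.map Prod.fst).foldl st q) b) := by
    intro y c
    simp
  cases k
  · change _ ↔ st ((v.map Prod.fst).foldl (hitStep st F) (q, False)).1 b ∈ F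
    rw [foldl_hitStep]
    constructor
    · rintro ⟨v', c, e, z', hz, ⟨rfl, hd⟩, hq⟩
      rcases append_cons_eq_append_cons hz with ⟨y, rfl, -⟩ | ⟨rfl, hb, -⟩ | ⟨y, rfl, -⟩
      · simp at h
      · obtain ⟨rfl, -⟩ := Prod.mk.inj hb
        simpa using hq
      · simp at hd
    · intro hq
      exact ⟨v, b, d, z, rfl, ⟨rfl, h⟩, by simpa using hq⟩
  · change _ ↔ st ((v.map Prod.fst).foldl (hitStep st F) (q, False)).1 b ∈ _ ∨
      st ((v.map Prod.fst).foldl (hitStep st F) (q, False)).1 b ∈ _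
    rw [foldl_hitStep]
    constructor
    · rintro ⟨v', c, e, z', hz, ⟨rfl, hd⟩, hq⟩
      rcases append_cons_eq_append_cons hz with ⟨y, rfl, -⟩ | ⟨rfl, hb, -⟩ | ⟨y, rfl, rfl⟩
      · simp at h
      · exact absurd hd h
      · rw [hfold] at hq
        by_cases hy : d ∈ y.map Prod.snd
        · exact Or.inr ⟨y, c, d, z', rfl, ⟨rfl, hy⟩, hq⟩
        · exact Or.inl ⟨y, c, d, z', rfl, ⟨rfl, hy⟩, hq⟩
    · rintro (⟨y, c, e, z', rfl, ⟨rfl, hd⟩, hq⟩ | ⟨y, c, e, z', rfl, ⟨rfl, hd⟩, hq⟩)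
      · exact ⟨v ++ (b, d) :: y, c, d, z', by simp, ⟨rfl, by simp⟩, by rw [hfold]; exact hq⟩
      · exact ⟨v ++ (b, d) :: y, c, d, z', by simp, ⟨rfl, by simp⟩, by rw [hfold]; exact hq⟩
  · change _ ↔ ((v.map Prod.fst).foldl (hitStep st F) (q, False)).2 ∨
      st ((v.map Prod.fst).foldl (hitStep st F) (q, False)).1 b ∈ _
    rw [foldl_hitStep]
    constructor
    · rintro ⟨v', c, e, z', hz, hd, hq⟩
      rcases append_cons_eq_append_cons hz with ⟨y, rfl, -⟩ | ⟨rfl, hb, -⟩ | ⟨y, rfl, rfl⟩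
      · exact Or.inl ⟨v'.map Prod.fst, c, y.map Prod.fst, by simp, hq⟩
      · exact absurd (Prod.mk.inj hb).2 hd
      · rw [hfold] at hq
        exact Or.inr ⟨y, c, e, z', rfl, hd, hq⟩
    · rintro (hq | ⟨y, c, e, z', rfl, hd, hq⟩)
      · rw [← (kindSet_of_notMem h).2.2] at hq
        obtain ⟨v₁, c, e, v₂, rfl, hd, hq⟩ := hq
        exact ⟨v₁, c, e, v₂ ++ (b, d) :: z, by simp, hd, hq⟩
      · exact ⟨v ++ (b, d) :: y, c, e, z', by simp, hd, by rw [hfold]; exact hq⟩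

end

variable [Finite T] [Finite σ]

/-- The conditions that force the labels to be the values of `anySet` and `kindSet`. -/
def classCond (st : σ → T → σ) (F : Set σ) : ClassCond (T × (Set σ × (Kind → Set σ))) where
  whole := .ofPred fun x => ∀ u b v, x = u ++ b :: v → b.2.1 = anySet st F (v.map Prod.fst)
  link := .ofPred fun x => ∃ a v b, x = a :: (v ++ [b]) ∧ a.2.2 =
    linkVal st F (fun q => (v.map Prod.fst).foldl (hitStep st F) (q, False)) b.1 b.2.2
  fst := Set.univ
  lst := {a | a.2.2 .next = ∅ ∧ a.2.2 .later = ∅ ∧ a.2.2 .diff = a.2.1}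
  whole_regular := by
    refine (Language.isRegular_suffix (B := T × (Set σ × (Kind → Set σ))) (C := Set σ)
      (fun b => b.2.1) (fun b N => {q | st q b.1 ∈ F ∨ st q b.1 ∈ N}) ∅).of_mem_iff fun x => ?_
    simp only [Language.mem_ofPred, anySet_eq_foldr, List.foldr_map]
  link_regular := by
    -- The start state `q` is arbitrary, so the fold carries the whole function of `q`, with
    -- finitely many possibilities.
    refine (Language.isRegular_factor (B := T × (Set σ × (Kind → Set σ)))
      (S := σ → σ × Prop) (fun g b q => hitStep st F (g q) b.1) (fun q => (q, False))
      (fun a g b => a.2.2 = linkVal st F g b.1 b.2.2)).of_mem_iff fun x => ?_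
    refine exists_congr fun a => exists_congr fun v => exists_congr fun b =>
      and_congr_right fun _ => ?_
    have : ∀ q, v.foldl (fun (g : σ → σ × Prop) b q => hitStep st F (g q) b.1)
        (fun q => (q, False)) q = (v.map Prod.fst).foldl (hitStep st F) (q, False) := by
      intro q
      rw [List.foldl_map]
      have key : ∀ (v : List (T × (Set σ × (Kind → Set σ)))) (g : σ → σ × Prop),
          v.foldl (fun (g : σ → σ × Prop) b q => hitStep st F (g q) b.1) g q =
            v.foldl (fun p b => hitStep st F p b.1) (g q) := by
        intro v
        induction v with
        | nil => intro g; rfl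
        | cons b v ih => intro g; rw [List.foldl_cons, List.foldl_cons, ih]
      exact key v _
    rw [funext this]

variable {st : σ → T → σ} {F : Set σ}

theorem mem_link_classCond {a b : T × (Set σ × (Kind → Set σ))}
    {v : List (T × (Set σ × (Kind → Set σ)))} :
    a :: (v ++ [b]) ∈ (classCond st F).link ↔ a.2.2 =
      linkVal st F (fun q => (v.map Prod.fst).foldl (hitStep st F) (q, False)) b.1 b.2.2 :=
  Language.cons_append_mem_factor (P := fun (a : T × (Set σ × (Kind → Set σ)))
    (v : List (T × (Set σ × (Kind → Set σ)))) b => a.2.2 =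
    linkVal st F (fun q => (v.map Prod.fst).foldl (hitStep st F) (q, False)) b.1 b.2.2)

theorem isAnnotation_classCond : IsAnnotation Prod.fst (classCond st F) D := by
  intro w
  obtain ⟨w', rfl, hw'⟩ := exists_annotate
    (fun _ d z => (anySet st F (z.map Prod.fst), kindSet st F d z)) w
  refine ⟨w', ⟨?_, ?_, fun _ _ _ _ _ _ => trivial, ?_⟩, rfl⟩
  · intro u b v hx
    obtain ⟨u, z, rfl, rfl, hz⟩ := List.map_eq_append_iff.1 hx
    obtain ⟨⟨b, d⟩, z, rfl, rfl, rfl⟩ := List.map_eq_cons_iff.1 hz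
    rw [hw' u b d z rfl, relabel_map_fst]
  · intro u a d v b z hw hd
    rw [mem_link_classCond, hw' u a d _ hw, hw' (u ++ (a, d) :: v) b d z (by simp [hw]),
      relabel_append, relabel_cons]
    dsimp only
    rw [kindSet_append (by simpa using hd), relabel_map_fst]
  · intro u a d z hw hd
    have := hw' u a d z hw
    change a.2.2 .next = ∅ ∧ a.2.2 .later = ∅ ∧ a.2.2 .diff = a.2.1
    rw [this]
    exact kindSet_of_notMem (by simpa using hd)

/-- The conditions pin the labels down: by `kindSet_of_notMem` at the last occurrence of a value,
and by the recurrence backwards from each occurrence to the previous one. -/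
theorem eq_kindSet_of_holds {w : List ((T × (Set σ × (Kind → Set σ))) × D)}
    (h : (classCond st F).Holds w) : ∀ u a d z, w = u ++ (a, d) :: z →
      a.2.2 = kindSet st F d (relabel Prod.fst z) := by
  suffices ∀ (n : ℕ) (z : List _), z.length = n → ∀ u a d, w = u ++ (a, d) :: z →
      a.2.2 = kindSet st F d (relabel Prod.fst z) from fun u a d z => this _ z rfl u a d
  intro n
  induction n using Nat.strong_induction_on with
  | _ n ih =>
    intro z hn u a d hw
    by_cases hd : d ∈ z.map Prod.snd
    · obtain ⟨v, b, z, rfl, hv⟩ := exists_eq_append_first hd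
      have h1 := ih z.length (by simp [← hn]; omega) z rfl (u ++ (a, d) :: v) b d (by simp [hw])
      have h2 := mem_link_classCond.1 (h.link u a d v b z hw hv)
      rw [h2, h1, relabel_append, relabel_cons, kindSet_append (by simpa using hv), relabel_map_fst]
    · obtain ⟨h1, h2, h3⟩ := h.lst u a d z hw hd
      obtain ⟨h4, h5, h6⟩ := kindSet_of_notMem (st := st) (F := F) (d := d)
        (z := relabel Prod.fst z) (by simpa using hd)
      have h7 := h.whole (u.map Prod.fst) a (z.map Prod.fst) (by simp [hw])
      funext k
      cases k
      · rw [h1, h4]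
      · rw [h2, h5]
      · rw [h3, h6, h7, relabel_map_fst]

end Future

/-! ### Witnesses after and before a position -/

section

universe u

variable {T : Type u} {D : Type*} [Finite T]

theorem Recognizable.future {K : Language T} (hK : K.IsRegular) (k : Kind) :
    Recognizable (fun _ a d z => ∃ v b e z', z = v ++ (b, e) :: z' ∧
      k.Holds d (v.map Prod.snd) e ∧ a :: (v.map Prod.fst ++ [b]) ∈ K :
        List (T × D) → T → D → List (T × D) → Prop) := by
  obtain ⟨σ, _, st, s₀, F, hF⟩ := hK.exists_foldl
  refine ⟨T × (Set σ × (Kind → Set σ)), inferInstance, Prod.fst, Future.classCond st F,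
    {t | st s₀ t.1 ∈ t.2.2 k}, Future.isAnnotation_classCond, fun u a d z h => ?_⟩
  change st s₀ a.1 ∈ a.2.2 k ↔ _
  rw [Future.eq_kindSet_of_holds h u a d z rfl]
  simp only [hF]
  rfl

theorem Recognizable.past {K : Language T} (hK : K.IsRegular) (k : Kind) :
    Recognizable (fun u a d _ => ∃ u' b e v, u = u' ++ (b, e) :: v ∧
      k.Holds e (v.map Prod.snd) d ∧ b :: (v.map Prod.fst ++ [a]) ∈ K :
        List (T × D) → T → D → List (T × D) → Prop) := by
  refine (Recognizable.future hK.reverse k).reverse.congr fun u a d z => ?_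
  constructor
  · rintro ⟨u', b, e, v, rfl, h1, h2⟩
    refine ⟨v.reverse, b, e, u'.reverse, by simp, ?_, ?_⟩
    · rwa [List.map_reverse, Kind.holds_reverse]
    · rw [Language.mem_reverse]; simpa using h2
  · rintro ⟨v, b, e, z', h, h1, h2⟩
    refine ⟨z'.reverse, b, e, v.reverse, ?_, ?_, ?_⟩
    · rw [← List.reverse_reverse u, h]; simp
    · rwa [List.map_reverse, Kind.holds_reverse]
    · rw [Language.mem_reverse] at h2; simpa using h2

end

/-! ### Definable data languages are class-regular -/

namespace FO2

universe u

variable {A : Type u} {D : Type*} {k : ℕ}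

open DataWord

/-- The letters `S` and the regular languages `K₁`, `K₂` of the factors between two positions
determine the relation `P` on the positions of annotated data words. -/
structure Describes {T : Type*} (P : PosRel A D k) (π : T → A × Set (Fin k)) (C : ClassCond T)
    (K₁ K₂ : Kind → Language T) (S : Set T) : Prop where
  annot : IsAnnotation π C D
  reg₁ : ∀ κ, (K₁ κ).IsRegular
  reg₂ : ∀ κ, (K₂ κ).IsRegular
  diag : ∀ w X w', C.Holds w' → relabel π w' = expandData w X →
    ∀ u a d z, w' = u ++ (a, d) :: z → ∀ i : Fin w.length, (i : ℕ) = u.length → (P w X i i ↔ a ∈ S)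
  off : ∀ w X w', C.Holds w' → relabel π w' = expandData w X →
    ∀ u a d v b e z, w' = u ++ (a, d) :: (v ++ (b, e) :: z) → ∀ i j : Fin w.length, (i : ℕ) = u.length →
      (j : ℕ) = u.length + 1 + v.length → ∀ κ : Kind, κ.Holds d (v.map Prod.snd) e →
      (P w X i j ↔ a :: (v.map Prod.fst ++ [b]) ∈ K₁ κ) ∧
      (P w X j i ↔ a :: (v.map Prod.fst ++ [b]) ∈ K₂ κ)

/-- Relations that are determined by regular languages on annotated data words. -/
def Described (P : PosRel A D k) : Prop :=
  ∃ (T : Type u) (_ : Finite T) (π : T → A × Set (Fin k)) (C : ClassCond T)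
    (K₁ K₂ : Kind → Language T) (S : Set T), Describes P π C K₁ K₂ S

namespace Described

variable {P P' : PosRel A D k}

theorem congr (h : Described P) (h' : ∀ w X i j, P' w X i j ↔ P w X i j) : Described P' := by
  have : P' = P := by
    funext w X i j
    exact propext (h' w X i j)
  rwa [this]

theorem not (h : Described P) : Described fun w X i j => ¬ P w X i j := by
  obtain ⟨T, _, π, C, K₁, K₂, S, h⟩ := h
  exact ⟨T, inferInstance, π, C, fun κ => (K₁ κ)ᶜ, fun κ => (K₂ κ)ᶜ, Sᶜ, h.annot,
    fun κ => (h.reg₁ κ).compl, fun κ => (h.reg₂ κ).compl,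
    fun w X w' hC hw u a d z hz i hi => not_congr (h.diag w X w' hC hw u a d z hz i hi),
    fun w X w' hC hw u a d v b e z hz i j hi hj κ hκ =>
      ⟨not_congr (h.off w X w' hC hw u a d v b e z hz i j hi hj κ hκ).1,
        not_congr (h.off w X w' hC hw u a d v b e z hz i j hi hj κ hκ).2⟩⟩

/-- Both annotations are carried side by side; each language looks at its own component. -/
theorem and (h : Described P) (h' : Described P') :
    Described fun w X i j => P w X i j ∧ P' w X i j := by
  obtain ⟨T, _, π, C, K₁, K₂, S, h⟩ := h
  obtain ⟨T', _, π', C', K₁', K₂', S', h'⟩ := h'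
  refine ⟨T × T', inferInstance, π ∘ Prod.fst, .join π C π' C',
    fun κ => .ofPred (fun x => x.map Prod.fst ∈ K₁ κ) ⊓ .ofPred fun x => x.map Prod.snd ∈ K₁' κ,
    fun κ => .ofPred (fun x => x.map Prod.fst ∈ K₂ κ) ⊓ .ofPred fun x => x.map Prod.snd ∈ K₂' κ,
    {t | t.1 ∈ S ∧ t.2 ∈ S'}, ClassCond.isAnnotation_join h.annot h'.annot,
    fun κ => ((h.reg₁ κ).preimage_map _).inf ((h'.reg₁ κ).preimage_map _),
    fun κ => ((h.reg₂ κ).preimage_map _).inf ((h'.reg₂ κ).preimage_map _), ?_, ?_⟩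
  · rintro w X w' hC hw u a d z rfl i hi
    obtain ⟨h1, h2, h3⟩ := ClassCond.holds_join.1 hC
    have hw' := hw
    rw [relabel_comp_fst_eq h3, ← relabel_relabel] at hw'
    rw [← relabel_relabel] at hw
    exact and_congr (h.diag w X _ h1 hw (relabel Prod.fst u) a.1 d (relabel Prod.fst z)
      (by simp) i (by simpa using hi)) (h'.diag w X _ h2 hw' (relabel Prod.snd u) a.2 d
      (relabel Prod.snd z) (by simp) i (by simpa using hi))
  · rintro w X w' hC hw u a d v b e z rfl i j hi hj κ hκ
    obtain ⟨h1, h2, h3⟩ := ClassCond.holds_join.1 hC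
    have hw' := hw
    rw [relabel_comp_fst_eq h3, ← relabel_relabel] at hw'
    rw [← relabel_relabel] at hw
    have e1 := h.off w X _ h1 hw (relabel Prod.fst u) a.1 d (relabel Prod.fst v) b.1 e
      (relabel Prod.fst z) (by simp) i j (by simpa using hi) (by simpa using hj) κ
      (by simpa using hκ)
    have e2 := h'.off w X _ h2 hw' (relabel Prod.snd u) a.2 d (relabel Prod.snd v) b.2 e
      (relabel Prod.snd z) (by simp) i j (by simpa using hi) (by simpa using hj) κ
      (by simpa using hκ)
    rw [relabel_map_fst] at e1 e2
    constructor
    · rw [e1.1, e2.1]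
      simp [Language.mem_inf]
    · rw [e1.2, e2.2]
      simp [Language.mem_inf]

theorem swap (h : Described P) : Described fun w X i j => P w X j i := by
  obtain ⟨T, _, π, C, K₁, K₂, S, h⟩ := h
  exact ⟨T, inferInstance, π, C, K₂, K₁, S, h.annot, h.reg₂, h.reg₁, h.diag,
    fun w X w' hC hw u a d v b e z hz i j hi hj κ hκ =>
      (h.off w X w' hC hw u a d v b e z hz i j hi hj κ hκ).symm⟩

/-- The languages only inspect the end letter at the relevant position: the first letter if `i`
comes first, the last letter if it comes second. -/
theorem of_unary {Q : ∀ (w : List (A × D)) (_ : Fin k → Set (Fin w.length)), Fin w.length → Prop}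
    {T : Type u} [Finite T] {π : T → A × Set (Fin k)} {C : ClassCond T} {S : Set T}
    (hA : IsAnnotation π C D) (h : ∀ w X w', C.Holds w' → relabel π w' = expandData w X →
      ∀ u a d z, w' = u ++ (a, d) :: z → ∀ i : Fin w.length, (i : ℕ) = u.length → (Q w X i ↔ a ∈ S)) :
    Described fun w X i _ => Q w X i := by
  refine ⟨T, inferInstance, π, C, fun _ => .ofPred fun x => ∃ a ∈ x.head?, a ∈ S,
    fun _ => .ofPred fun x => ∃ a ∈ x.getLast?, a ∈ S, S, hA,
    fun _ => Language.isRegular_head fun o => ∃ a ∈ o, a ∈ S,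
    fun _ => Language.isRegular_getLast fun o => ∃ a ∈ o, a ∈ S, h, ?_⟩
  rintro w X w' hC hw u a d v b e z hz i j hi hj κ -
  rw [h w X w' hC hw u a d _ hz i hi, h w X w' hC hw (u ++ (a, d) :: v) b e z (by simp [hz]) j
    (by simp; omega)]
  constructor
  · simp
  · rw [Language.mem_ofPred, ← List.cons_append, List.getLast?_concat]
    simp

theorem diagonal (h : Described P) : Described fun w X i _ => P w X i i := by
  obtain ⟨T, _, π, C, K₁, K₂, S, h⟩ := h
  exact of_unary (Q := fun w X i => P w X i i) h.annot h.diag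

/-- Relations between two variables of a formula. -/
theorem of_vars (h : Described P) (x y : Fin 2) :
    Described fun w X i j => P w X (![i, j] x) (![i, j] y) := by
  fin_cases x <;> fin_cases y
  · exact h.diagonal
  · exact h
  · exact h.swap
  · exact h.diagonal.swap

/-- A witness is `i` itself or lies after or before `i` in one of three kinds. Each of these seven
cases is a recognizable unary property over the annotated alphabet, so one further annotation makes
their disjunction visible in the letter at `i`. -/
theorem exists_snd (h : Described P) : Described fun w X i _ => ∃ j, P w X i j := by
  obtain ⟨T, _, π, C, K₁, K₂, S, h⟩ := h
  obtain ⟨T', _, π', C', S', hA, hU⟩ := ((((((Recognizable.of_letter (D := D) S).or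
    (.future (h.reg₁ .next) .next)).or (.future (h.reg₁ .later) .later)).or
    (.future (h.reg₁ .diff) .diff)).or (.past (h.reg₂ .next) .next)).or
    (.past (h.reg₂ .later) .later)).or (.past (h.reg₂ .diff) .diff)
  refine of_unary (π := π ∘ π') (S := S') (hA.comp h.annot) ?_
  rintro w X w' hC hw u a d z rfl i hi
  obtain ⟨h1, h2⟩ := ClassCond.holds_inter.1 hC
  rw [hU u a d z h1]
  rw [ClassCond.holds_comap] at h2
  rw [← relabel_relabel] at hw
  rw [relabel_append, relabel_cons] at h2 hw
  rw [← relabel_length π'] at hi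
  generalize relabel π' u = u at h2 hw hi
  generalize relabel π' z = z at h2 hw hi
  generalize π' a = a at h2 hw hi
  have hlen : w.length = u.length + (z.length + 1) := by
    rw [← length_expandData (X := X), ← hw]
    simp
  have hfut : ∀ v b e z' κ, z = v ++ (b, e) :: z' → κ.Holds d (v.map Prod.snd) e →
      a :: (v.map Prod.fst ++ [b]) ∈ K₁ κ → ∃ j, P w X i j := by
    rintro v b e z' κ rfl h3 h4
    simp only [List.length_append, List.length_cons] at hlen
    exact ⟨⟨u.length + 1 + v.length, by omega⟩,
      (h.off w X _ h2 hw u a d v b e z' rfl i _ hi rfl κ h3).1.2 h4⟩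
  have hpast : ∀ u' b e v κ, u = u' ++ (b, e) :: v → κ.Holds e (v.map Prod.snd) d →
      b :: (v.map Prod.fst ++ [a]) ∈ K₂ κ → ∃ j, P w X i j := by
    rintro u' b e v κ rfl h3 h4
    simp only [List.length_append, List.length_cons] at hlen hi
    exact ⟨⟨u'.length, by omega⟩,
      (h.off w X _ h2 hw u' b e v a d z (by simp) _ i rfl (by omega) κ h3).2.2 h4⟩
  constructor
  · rintro ⟨j, hj⟩
    rcases lt_trichotomy i j with hij | rfl | hij
    · rw [Fin.lt_def] at hij
      obtain ⟨v, ⟨b, e⟩, z', rfl, hv⟩ := exists_split z (i := j - i - 1) (by omega)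
      obtain ⟨κ, hκ⟩ := Kind.exists_holds d (v.map Prod.snd) e
      have h3 := (h.off w X _ h2 hw u a d v b e z' rfl i j hi (by omega) κ hκ).1.1 hj
      cases κ
      · exact Or.inl (Or.inl (Or.inl (Or.inl (Or.inl (Or.inr ⟨v, b, e, z', rfl, hκ, h3⟩)))))
      · exact Or.inl (Or.inl (Or.inl (Or.inl (Or.inr ⟨v, b, e, z', rfl, hκ, h3⟩))))
      · exact Or.inl (Or.inl (Or.inl (Or.inr ⟨v, b, e, z', rfl, hκ, h3⟩)))
    · exact Or.inl (Or.inl (Or.inl (Or.inl (Or.inl (Or.inl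
        ((h.diag w X _ h2 hw u a d z rfl i hi).1 hj))))))
    · rw [Fin.lt_def] at hij
      obtain ⟨u', ⟨b, e⟩, v, rfl, hu⟩ := exists_split u (i := j) (by omega)
      obtain ⟨κ, hκ⟩ := Kind.exists_holds e (v.map Prod.snd) d
      simp only [List.length_append, List.length_cons] at hi
      have h3 := (h.off w X _ h2 hw u' b e v a d z (by simp) j i hu.symm (by omega) κ hκ).2.1 hj
      cases κ
      · exact Or.inl (Or.inl (Or.inr ⟨u', b, e, v, rfl, hκ, h3⟩))
      · exact Or.inl (Or.inr ⟨u', b, e, v, rfl, hκ, h3⟩)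
      · exact Or.inr ⟨u', b, e, v, rfl, hκ, h3⟩
  · rintro ((((((h3 | ⟨v, b, e, z', h3, h4, h5⟩) | ⟨v, b, e, z', h3, h4, h5⟩) |
      ⟨v, b, e, z', h3, h4, h5⟩) | ⟨u', b, e, v, h3, h4, h5⟩) | ⟨u', b, e, v, h3, h4, h5⟩) |
      ⟨u', b, e, v, h3, h4, h5⟩)
    · exact ⟨i, (h.diag w X _ h2 hw u a d z rfl i hi).2 h3⟩
    · exact hfut v b e z' _ h3 h4 h5
    · exact hfut v b e z' _ h3 h4 h5
    · exact hfut v b e z' _ h3 h4 h5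
    · exact hpast u' b e v _ h3 h4 h5
    · exact hpast u' b e v _ h3 h4 h5
    · exact hpast u' b e v _ h3 h4 h5

theorem exists_fst (h : Described P) : Described fun w X _ j => ∃ i, P w X i j :=
  h.swap.exists_snd.swap

theorem isAnnotation_id : IsAnnotation id (.ofWhole _ (Language.isRegular_setOf_const True) :
    ClassCond (A × Set (Fin k))) D :=
  fun w => ⟨w, ClassCond.holds_ofWhole.2 trivial, relabel_id w⟩

variable [Finite A]

theorem of_letter (S : Set (A × Set (Fin k))) :
    Described (fun w X i _ => ((w.get i).1, {m | i ∈ X m}) ∈ S : PosRel A D k) := by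
  refine of_unary (Q := fun w X i => ((w.get i).1, {m | i ∈ X m}) ∈ S) isAnnotation_id (S := S) ?_
  intro w X w' _ hw u a d z hz i hi
  rw [relabel_id] at hw
  rw [(Prod.mk.inj (expandData_split (hw.symm.trans hz) hi)).1]

/-- Relations that can be read off without annotations. -/
theorem of_languages {K₁ K₂ : Kind → Language (A × Set (Fin k))} (p : Prop)
    (h₁ : ∀ κ, (K₁ κ).IsRegular) (h₂ : ∀ κ, (K₂ κ).IsRegular) (h : ∀ w X i, P w X i i ↔ p)
    (h' : ∀ w X u a d v b e z, expandData w X = u ++ (a, d) :: (v ++ (b, e) :: z) → ∀ i j : Fin w.length,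
      (i : ℕ) = u.length → (j : ℕ) = u.length + 1 + v.length → ∀ κ : Kind,
      κ.Holds d (v.map Prod.snd) e → (P w X i j ↔ a :: (v.map Prod.fst ++ [b]) ∈ K₁ κ) ∧
      (P w X j i ↔ a :: (v.map Prod.fst ++ [b]) ∈ K₂ κ)) : Described P := by
  refine ⟨_, inferInstance, id, _, K₁, K₂, {_a | p}, isAnnotation_id, h₁, h₂, ?_, ?_⟩
  · intro w X _ _ _ _ _ _ _ _ i _
    exact h w X i
  · intro w X w' _ hw u a d v b e z hz
    rw [relabel_id] at hw
    exact h' w X u a d v b e z (hw.symm.trans hz)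

theorem eq : Described (fun _ _ i j => i = j : PosRel A D k) := by
  refine of_languages True (fun _ => Language.isRegular_setOf_const False)
    (fun _ => Language.isRegular_setOf_const False) (by simp) ?_
  intro w X u a d v b e z _ i j hi hj _ _
  have := lt_of_split hi hj
  exact ⟨iff_of_false this.ne id, iff_of_false this.ne' id⟩

theorem lt : Described (fun _ _ i j => i < j : PosRel A D k) := by
  refine of_languages False (fun _ => Language.isRegular_setOf_const True)
    (fun _ => Language.isRegular_setOf_const False) (by simp) ?_
  intro w X u a d v b e z _ i j hi hj _ _
  have := lt_of_split hi hj
  exact ⟨iff_of_true this trivial, iff_of_false this.asymm id⟩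

theorem sim : Described (fun w _ i j => Sim w i j : PosRel A D k) := by
  refine of_languages True (fun κ => Language.isRegular_setOf_const (κ ≠ .diff))
    (fun κ => Language.isRegular_setOf_const (κ ≠ .diff)) (by simp [Sim]) ?_
  intro w X u a d v b e z h i j hi hj κ hκ
  have h1 := sim_iff_of_split h hi hj
  have h2 : Sim w j i ↔ Sim w i j := eq_comm
  rw [h2, h1]
  simp only [Language.mem_ofPred]
  cases κ
  · simp [hκ.1]
  · simp [hκ.1]
  · simpa using show d ≠ e from hκ

/-- For ordered positions, the kind `next` is by definition the class successor. -/
theorem classSucc : Described (fun w _ i j => ClassSucc w i j : PosRel A D k) := by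
  refine of_languages False (fun κ => Language.isRegular_setOf_const (κ = .next))
    (fun _ => Language.isRegular_setOf_const False) (by simp [ClassSucc]) ?_
  intro w X u a d v b e z h i j hi hj κ hκ
  refine ⟨?_, iff_of_false (fun hc => (lt_of_split hi hj).asymm hc.1) id⟩
  rw [classSucc_iff_of_split h hi hj]
  simp only [Language.mem_ofPred]
  cases κ
  · exact iff_of_true hκ rfl
  · exact iff_of_false (fun h' => h'.2 hκ.2) (by simp)
  · exact iff_of_false (fun h' => hκ h'.1) (by simp)

theorem factor {L : Language (A × Set (Fin k))} (hL : L.IsRegular) :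
    Described (fun w X i j => Factor w X L i j : PosRel A D k) := by
  have hK : Language.IsRegular (.ofPred fun x => ∃ a v b, x = a :: (v ++ [b]) ∧ v ∈ L) := by
    obtain ⟨S, _, st, s₀, F, hF⟩ := hL.exists_foldl
    simp only [hF]
    exact Language.isRegular_factor st s₀ fun _ s _ => s ∈ F
  refine of_languages False (fun _ => hK)
    (fun _ => Language.isRegular_setOf_const False) (by simp [Factor]) ?_
  intro w X u a d v b e z h i j hi hj κ hκ
  refine ⟨?_, iff_of_false (fun hc => (lt_of_split hi hj).asymm hc.1) id⟩
  rw [factor_iff_of_split h hi hj]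
  exact (Language.cons_append_mem_factor (P := fun _ v _ => v ∈ L)).symm

/-- Successor is the regular predicate of the language containing only the empty word. -/
theorem succ : Described (fun _ _ i j => (i : ℕ) + 1 = (j : ℕ) : PosRel A D k) := by
  have hK : Language.IsRegular (.ofPred fun x : List (A × Set (Fin k)) => x = []) :=
    (Language.isRegular_forall_mem fun _ => False).of_mem_iff fun x => by
      simp [List.eq_nil_iff_forall_not_mem]
  refine (factor hK).congr fun w X i j => ?_
  rcases lt_or_ge i j with hij | hij
  · obtain ⟨u, ⟨a, d⟩, v, ⟨b, e⟩, z, h, hi, hj⟩ := exists_split₂ (expandData w X)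
      (i := i) (j := j) hij (by simp)
    rw [factor_iff_of_split h hi.symm hj.symm, Language.mem_ofPred, List.map_eq_nil_iff,
      ← List.length_eq_zero_iff]
    omega
  · refine iff_of_false ?_ fun h => absurd h.1 (not_lt.2 hij)
    rw [Fin.le_def] at hij
    omega

end Described

/-! ### Induction on formulas, and the passage to sentences -/

theorem assign_apply {n : ℕ} (i j : Fin n) (x : Fin 2) : assign i j x = some (![i, j] x) := by
  fin_cases x <;> rfl

theorem described_sat [Finite A] (φ : FO2 A k) :
    Described (fun w X i j => φ.Sat w X (assign i j) : PosRel A D k) := by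
  induction φ with
  | eq x y =>
    exact (Described.eq.of_vars x y).congr fun w X i j => by simp [Sat, assign_apply, eq_comm]
  | letter a x =>
    refine ((Described.of_letter {b | b.1 = a}).of_vars x x).congr fun w X i j => ?_
    simp [Sat, assign_apply]
  | mon m x =>
    refine ((Described.of_letter {b | m ∈ b.2}).of_vars x x).congr fun w X i j => ?_
    simp [Sat, assign_apply]
  | lt x y => exact (Described.lt.of_vars x y).congr fun w X i j => by simp [Sat, assign_apply]
  | succ x y => exact (Described.succ.of_vars x y).congr fun w X i j => by simp [Sat, assign_apply]
  | sim x y => exact (Described.sim.of_vars x y).congr fun w X i j => by simp [Sat, assign_apply]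
  | csucc x y =>
    exact (Described.classSucc.of_vars x y).congr fun w X i j => by simp [Sat, assign_apply]
  | reg L hL x y =>
    exact ((Described.factor hL).of_vars x y).congr fun w X i j => by simp [Sat, assign_apply]
  | neg φ ih => exact ih.not
  | and φ ψ ih ih' => exact ih.and ih'
  | ex x φ ih =>
    fin_cases x
    · refine ih.exists_fst.congr fun w X i j => exists_congr fun i' => ?_
      rw [← update_assign_zero i j i']
      rfl
    · refine ih.exists_snd.congr fun w X i j => exists_congr fun j' => ?_
      rw [← update_assign_one i j j']
      rfl

/-- Bridges the undefined assignment used for sentences and the total assignments used for described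
relations. -/
theorem sat_congr {w : List (A × D)} {X : Fin k → Set (Fin w.length)} {φ : FO2 A k}
    {ν ν' : Fin 2 → Option (Fin w.length)} (h : ∀ x ∈ φ.freeVars, ν x = ν' x) :
    φ.Sat w X ν ↔ φ.Sat w X ν' := by
  induction φ generalizing ν ν' with
  | letter a x | mon m x => simp only [Sat, h x rfl]
  | eq x y | lt x y | succ x y | sim x y | csucc x y | reg _ _ x y =>
    simp only [Sat, h x (Or.inl rfl), h y (Or.inr rfl)]
  | neg φ ih => exact not_congr (ih h)
  | and φ ψ ih ih' =>
    exact and_congr (ih fun x hx => h x (Or.inl hx)) (ih' fun x hx => h x (Or.inr hx))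
  | ex x φ ih =>
    refine exists_congr fun i => ih fun y hy => ?_
    by_cases hxy : y = x
    · subst hxy; simp
    · rw [Function.update_of_ne hxy, Function.update_of_ne hxy]
      exact h y ⟨hy, hxy⟩

end FO2

theorem DefinableInEMSO2.isClassRegular {A D : Type*} [Finite A] {L : Set (List (A × D))}
    (h : DefinableInEMSO2 L) : IsClassRegular L := by
  obtain ⟨⟨k, φ, hφ⟩, rfl⟩ := h
  obtain ⟨T, _, π, C, K₁, K₂, S, hP⟩ := φ.described_sat (D := D)
  -- The empty word has no position at which truth could be read off, so its truth value is built
  -- into `R` as the default for a missing first letter.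
  let p : Prop := φ.Sat ([] : List (A × D)) (fun _ => ∅) fun _ => none
  let R : Language T := .ofPred fun x => (fun o : Option T => o.elim p (· ∈ S)) x.head?
  have hR : R.IsRegular := Language.isRegular_head fun o : Option T => o.elim p (· ∈ S)
  have key : ∀ (w : List (A × D)) (X : Fin k → Set (Fin w.length)) (w' : List (T × D)),
      C.Holds w' → relabel π w' = DataWord.expandData w X →
      (φ.Sat w X (fun _ => none) ↔ w'.map Prod.fst ∈ R) := by
    intro w X w' hC hw
    have hlen : w'.length = w.length := by
      rw [← DataWord.length_expandData (X := X), ← hw, relabel_length]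
    rcases w with _ | ⟨q, w⟩
    · obtain rfl : w' = [] := List.length_eq_zero_iff.1 hlen
      have : X = fun _ => ∅ := by
        funext m
        ext i
        exact i.elim0
      rw [this]
      rfl
    · rcases w' with _ | ⟨⟨a, d⟩, z⟩
      · simp at hlen
      -- Both variables are placed at the first position, where truth is membership of the annotated
      -- letter in `S`.
      · have h1 := hP.diag _ X _ hC hw [] a d z rfl ⟨0, by simp⟩ rfl
        refine (FO2.sat_congr ?_).trans h1
        intro x hx
        rw [hφ] at hx
        exact hx.elim
  refine isClassRegular_of_finite (Prod.fst ∘ π) (C.inter (.ofWhole R hR)) fun w => ?_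
  constructor
  · rintro ⟨X, hX⟩
    obtain ⟨w', hC, hw'⟩ := hP.annot (DataWord.expandData w X)
    refine ⟨w', ClassCond.holds_inter.2 ⟨hC, ClassCond.holds_ofWhole.2
      ((key w X w' hC hw').1 hX)⟩, ?_⟩
    rw [← relabel_relabel, hw', DataWord.relabel_fst_expandData]
  · rintro ⟨w', hw', rfl⟩
    obtain ⟨hC, hR'⟩ := ClassCond.holds_inter.1 hw'
    obtain ⟨X, hX⟩ := DataWord.exists_expandData_eq (w := relabel (Prod.fst ∘ π) w')
      (relabel π w') (relabel_relabel _ _ _)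
    exact ⟨X, (key _ X w' hC hX.symm).2 (ClassCond.holds_ofWhole.1 hR')⟩

theorem mainTheorem8 {A : Type*} [Finite A] {D : Type*} [Infinite D]
    (L : Set (List (A × D))) :
    AcceptedBySetAutomaton L ↔ DefinableInEMSO2 L :=
  ⟨fun h => h.isClassRegular.definable, fun h => h.isClassRegular.acceptedBySetAutomaton⟩
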